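/- All graphs are finite and simple, trees are nonempty, and a vertex set is connected if it induces a nonempty connected subgraph. \textbf{Definitions.} Let $G$ be a graph and $k\ge 0$ an integer. \emph{Minors and products.} $H$ is a minor of $G$ if there are pairwise disjoint connected sets $\mu(u)\subseteq V(G)$, $u\in V(H)$, such that for every edge $uv$ of $H$ some edge of $G$ joins $\mu(u)$ to $\mu(v)$. The lexicographic product $G\cdot H$ has vertex set $V(G)\times V(H)$, and $(u,v)$, $(w,z)$ are adjacent iff $uw\in E(G)$, or $u=w$ and $vz\in E(H)$. Let $\mathsf{ltp}(G)$ be the minimum $k$ such that $G$ is a minor of $T\cdot K_k$ for some tree $T$. \emph{Lenient tree decompositions.} A lenient tree decomposition of $G$ is a pair $(T,\chi)$, with $T$ a tree and $\chi:V(T)\to 2^{V(G)}$, such that $\bigcup_t\chi(t)=V(G)$; for every edge $e$ of $G$ there are $t,t'\in V(T)$, equal or adjacent in $T$, with $e\subseteq\chi(t)\cup\chi(t')$; and for every $x\in V(G)$ the set $\{t: x\in\chi(t)\}$ is connected in $T$. Its width is $\max_t|\chi(t)|$. \emph{Strict brambles.} A strict bramble of $G$ is a collection $\mathcal B$ of connected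 vertex sets, every two of which intersect. Its order is the minimum size of a vertex set meeting every member of $\mathcal B$. Let $\mathsf{sbn}(G)$ be the maximum order of a strict bramble of $G$. \emph{Separators and cliques.} A set $S\subseteq V(G)$ is an $(x,y)$-separator if $x,y\notin S$ lie in different connected components of $G-S$; it is a minimal separator if for some $x,y$ it is an inclusion-minimal $(x,y)$-separator. The connectivity-degree of $S$ is the number of connected components of $G-S$. We identify a maximal clique with its vertex set. A maximal clique is external if it contains at most one minimal separator. For a minimal separator $S$, let $\mathcal K_G(S)$ be the set of external maximal cliques containing $S$; $S$ is external if $\mathcal K_G(S)\neq\emptyset$ and internal otherwise. $G$ is chordal if all its induced cycles are triangles. \emph{$k$-domino-trees.} $G$ is a $k$-domino-tree if it is a complete graph $K_r$ with $r\le k$, or it satisfies all of the following: (i) $G$ is chordal; (ii) every minimal separator has size $k$; (iii) every maximal clique has size in $[k+1,2k]$; (iv) every maximal clique contains at most two minimal separators; (v) every maximal clique that contains exactly two minimal separators $S,S'$ equals $S\cup S'$; (vi) no internal minimal separator of connectivity-degree two is contained in the union of two other minimal separators; (vii) for every external minimal separator $S$ of connectivity-degree two, the union of the maximal cliques containing $S$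 has more than $2k$ vertices; (viii) for every external minimal separator $S$ and all distinct $K,K'\in\mathcal K_G(S)$, $|K\setminus S|+|K'\setminus S|>k$. \textbf{Theorem.} Let $G$ be a graph. For every $k\in\mathbb N=\{0,1,2,\dots\}$ the following statements are equivalent: (1) there is a tree $T$ such that $G$ is a minor of $T\cdot K_k$; (2) $G$ has a lenient tree decomposition of width at most $k$; (3) $G$ has no strict bramble of order greater than $k$; (4) $G$ is a spanning subgraph of a $k$-domino-tree. In particular, the maximum defining $\mathsf{sbn}(G)$ and the minimum defining $\mathsf{ltp}(G)$ exist, and $\mathsf{sbn}(G)=\mathsf{ltp}(G)=$ the minimum width of a lenient tree decomposition of $G$. -/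

import Mathlib

namespace LenientTree

/-! Graphs are simple graphs on a finite vertex type. -/

/-- A vertex set is connected if it induces a connected (in particular nonempty) subgraph. -/
def IsConnectedSet {V : Type*} (G : SimpleGraph V) (S : Set V) : Prop :=
  (G.induce S).Connected

/-! ### Strict brambles -/

/-- A collection of connected vertex sets, every two of which have a vertex in common. -/
structure IsStrictBramble {V : Type*} (G : SimpleGraph V) (B : Set (Set V)) : Prop where
  connected : ∀ S ∈ B, IsConnectedSet G S
  intersecting : ∀ S ∈ B, ∀ S' ∈ B, (S ∩ S').Nonempty

/-- `X` covers `B` if every member of `B` has a vertex in `X`. -/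
def Covers {V : Type*} (X : Set V) (B : Set (Set V)) : Prop :=
  ∀ S ∈ B, (S ∩ X).Nonempty

/-- The order of a collection of vertex sets: the minimum size of a cover. (The whole vertex set
covers every strict bramble, so the minimum exists for strict brambles of finite graphs.) -/
noncomputable def order {V : Type*} (B : Set (Set V)) : ℕ :=
  sInf {n : ℕ | ∃ X : Set V, Covers X B ∧ X.ncard = n}

/-- The orders of the strict brambles of `G`. -/
def strictBrambleOrders {V : Type*} (G : SimpleGraph V) : Set ℕ :=
  {n | ∃ B : Set (Set V), IsStrictBramble G B ∧ order B = n}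

/-- The strict bramble number: the maximum order of a strict bramble. -/
noncomputable def sbn {V : Type*} (G : SimpleGraph V) : ℕ :=
  sSup (strictBrambleOrders G)

/-! ### Minors and the lexicographic tree product number -/

/-- The lexicographic product `G · H`. -/
def lexProduct {α β : Type*} (G : SimpleGraph α) (H : SimpleGraph β) : SimpleGraph (α × β) where
  Adj p q := G.Adj p.1 q.1 ∨ (p.1 = q.1 ∧ H.Adj p.2 q.2)
  symm := ⟨by
    rintro p q (h | ⟨h, h'⟩)
    · exact Or.inl h.symm
    · exact Or.inr ⟨h.symm, h'.symm⟩⟩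
  loopless := ⟨by
    rintro p (h | ⟨-, h⟩)
    · exact G.loopless.irrefl _ h
    · exact H.loopless.irrefl _ h⟩

/-- `μ` is a minor model of `H` in `G`: pairwise disjoint connected branch sets, with an edge of
`G` between the branch sets of adjacent vertices of `H`. -/
structure IsMinorModel {W V : Type*} (H : SimpleGraph W) (G : SimpleGraph V) (μ : W → Set V) :
    Prop where
  connected : ∀ u, IsConnectedSet G (μ u)
  disjoint : ∀ u v, u ≠ v → Disjoint (μ u) (μ v)
  adj : ∀ u v, H.Adj u v → ∃ w ∈ μ u, ∃ z ∈ μ v, G.Adj w z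

/-- `H` is a minor of `G`. -/
def IsMinor {W V : Type*} (H : SimpleGraph W) (G : SimpleGraph V) : Prop :=
  ∃ μ : W → Set V, IsMinorModel H G μ

/-- `G` is a minor of `T · K_k` for some finite tree `T`. -/
def IsMinorOfTreeProduct {V : Type*} (G : SimpleGraph V) (k : ℕ) : Prop :=
  ∃ (ι : Type) (_ : Finite ι) (T : SimpleGraph ι),
    T.IsTree ∧ IsMinor G (lexProduct T (⊤ : SimpleGraph (Fin k)))

/-- The lexicographic tree product number. -/
noncomputable def ltp {V : Type*} (G : SimpleGraph V) : ℕ :=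
  sInf {k : ℕ | IsMinorOfTreeProduct G k}

/-! ### Lenient tree decompositions -/

/-- `(T, χ)` is a lenient tree decomposition of `G`. -/
structure IsLenientTreeDecomposition {V ι : Type*} (G : SimpleGraph V) (T : SimpleGraph ι)
    (χ : ι → Set V) : Prop where
  isTree : T.IsTree
  cover : ⋃ t, χ t = Set.univ
  edge : ∀ x y, G.Adj x y →
    ∃ t t', (t = t' ∨ T.Adj t t') ∧ x ∈ χ t ∪ χ t' ∧ y ∈ χ t ∪ χ t'
  trace : ∀ x, IsConnectedSet T {t | x ∈ χ t}

/-- The width: the maximum size of a bag. -/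
noncomputable def width {V ι : Type*} (χ : ι → Set V) : ℕ :=
  ⨆ t, (χ t).ncard

/-- The widths of the lenient tree decompositions of `G` (over finite trees). -/
def lenientWidths {V : Type*} (G : SimpleGraph V) : Set ℕ :=
  {w | ∃ (ι : Type) (_ : Finite ι) (T : SimpleGraph ι) (χ : ι → Set V),
    IsLenientTreeDecomposition G T χ ∧ width χ = w}

/-! ### Chordal graphs, separators and `k`-domino-trees -/

/-- Every induced cycle is a triangle. -/
def IsChordal {V : Type*} (G : SimpleGraph V) : Prop :=
  ∀ n : ℕ, 3 ≤ n → SimpleGraph.IsIndContained (SimpleGraph.cycleGraph n) G → n = 3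

/-- `S` is an `(x, y)`-separator: `x` and `y` lie in different components of `G - S`. -/
def IsSeparator {V : Type*} (G : SimpleGraph V) (x y : V) (S : Set V) : Prop :=
  ∃ (hx : x ∈ Sᶜ) (hy : y ∈ Sᶜ), ¬ (G.induce Sᶜ).Reachable ⟨x, hx⟩ ⟨y, hy⟩

/-- `S` is a minimal `(x, y)`-separator for some `x`, `y`. -/
def IsMinimalSeparator {V : Type*} (G : SimpleGraph V) (S : Set V) : Prop :=
  ∃ x y, Minimal (IsSeparator G x y) S

/-- The number of connected components of `G - S`. -/
noncomputable def connectivityDegree {V : Type*} (G : SimpleGraph V) (S : Set V) : ℕ :=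
  Nat.card (G.induce Sᶜ).ConnectedComponent

/-- `K` is the vertex set of a maximal clique. -/
def IsMaxClique {V : Type*} (G : SimpleGraph V) (K : Set V) : Prop :=
  Maximal G.IsClique K

/-- The minimal separators of `G` contained in `K`. -/
def separatorsIn {V : Type*} (G : SimpleGraph V) (K : Set V) : Set (Set V) :=
  {S | IsMinimalSeparator G S ∧ S ⊆ K}

/-- The external family of `S`: the external maximal cliques (those containing at most one minimal
separator) that contain `S`. -/
def externalFamily {V : Type*} (G : SimpleGraph V) (S : Set V) : Set (Set V) :=
  {K | IsMaxClique G K ∧ (separatorsIn G K).ncard ≤ 1 ∧ S ⊆ K}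

/-- A minimal separator whose external family is nonempty. -/
def IsExternalSeparator {V : Type*} (G : SimpleGraph V) (S : Set V) : Prop :=
  IsMinimalSeparator G S ∧ (externalFamily G S).Nonempty

/-- A minimal separator whose external family is empty. -/
def IsInternalSeparator {V : Type*} (G : SimpleGraph V) (S : Set V) : Prop :=
  IsMinimalSeparator G S ∧ externalFamily G S = ∅

/-- The defining properties of a `k`-domino-tree that is not a complete graph on at most `k`
vertices. -/
structure DominoProperties {V : Type*} (G : SimpleGraph V) (k : ℕ) : Prop where
  chordal : IsChordal G
  separator_card : ∀ S, IsMinimalSeparator G S → S.ncard = k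
  clique_card : ∀ K, IsMaxClique G K → k + 1 ≤ K.ncard ∧ K.ncard ≤ 2 * k
  clique_separators : ∀ K, IsMaxClique G K → (separatorsIn G K).ncard ≤ 2
  clique_eq_union : ∀ K, IsMaxClique G K → ∀ S S', S ≠ S' →
    separatorsIn G K = {S, S'} → K = S ∪ S'
  internal_two : ∀ S, IsInternalSeparator G S → connectivityDegree G S = 2 →
    ∀ S₁ S₂, IsMinimalSeparator G S₁ → IsMinimalSeparator G S₂ →
      S₁ ≠ S → S₂ ≠ S → S₁ ≠ S₂ → ¬ S ⊆ S₁ ∪ S₂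
  external_two : ∀ S, IsExternalSeparator G S → connectivityDegree G S = 2 →
    2 * k < (⋃₀ {K | IsMaxClique G K ∧ S ⊆ K}).ncard
  external_valiancy : ∀ S, IsExternalSeparator G S →
    ∀ K ∈ externalFamily G S, ∀ K' ∈ externalFamily G S, K ≠ K' →
      k < (K \ S).ncard + (K' \ S).ncard

/-- `G` is a `k`-domino-tree. -/
def IsDominoTree {V : Type*} (G : SimpleGraph V) (k : ℕ) : Prop :=
  (G = ⊤ ∧ Nat.card V ≤ k) ∨ DominoProperties G k

/-- `G` is a spanning subgraph of a `k`-domino-tree. -/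
def IsPartialDominoTree {V : Type*} (G : SimpleGraph V) (k : ℕ) : Prop :=
  ∃ D : SimpleGraph V, G ≤ D ∧ IsDominoTree D k

end LenientTree

/-! The statements are linked by (1) ↔ (2) and (3) → (2) → (4) → (3).

Between (1) and (2): the bag of `t` consists of the vertices whose branch set meets the fibre over
`t`. Conversely, numbering each bag injectively by `Fin k` turns the trace of a vertex into a branch
set.

(3) → (2): call a decomposition admissible for a strict bramble `B` if no bag of more than `k`
vertices covers `B`. Admissible decompositions are built by induction from larger to smaller
brambles (`exists_admissible_decomposition`). Take a minimum cover `X` of `B`, so `X` has at most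
`k` vertices, and decompose each `G[X ∪ C]`, for `C` a component of `G - X`, with a bag `X`; these
pieces glue along `X`. If a member of `B` misses `C`, two bags suffice. Otherwise `B ∪ {C}` is a
larger strict bramble. Unless its decomposition is already admissible for `B`, some bag covers `B`
and avoids `C`, and the vertices of `X` are moved towards this bag
(`hasRootedDecomposition_of_covers`). No bag grows, because `X` is a minimum cover. The empty
bramble is covered by every set, so admissible for it means width at most `k`.

(2) → (4): up to `2k` vertices, complete graphs do. Beyond that, take an edge-maximal supergraph of
lenient width at most `k` and a decomposition of it with fewest nodes (`IsOptimal`). Maximality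
makes unions of adjacent bags cliques and fills the inner bags. The minimal separators are exactly
the inner bags, and every maximal clique is the union of two adjacent bags. Violations of
(vi)–(viii) would allow a node to be removed by contraction or merging.

(4) → (3): a bramble of order above `k` has a member in some component of `G - S`, for each minimal
separator `S`. Choosing such a component as small as possible and inspecting a maximal clique that
enters it from `S` contradicts (i)–(v) (`DominoProperties.not_lt_order`). -/

namespace LenientTree

/-! ### Connected vertex sets and components. -/

section Connected

variable {V ι : Type*} {G : SimpleGraph V}

/-- A nonempty set is connected if and only if no proper part of it is closed under adjacency. -/
theorem isConnectedSet_iff {S : Set V} :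
    IsConnectedSet G S ↔ S.Nonempty ∧ ∀ U : Set V, (S ∩ U).Nonempty →
      (∀ x ∈ S, x ∈ U → ∀ y ∈ S, G.Adj x y → y ∈ U) → S ⊆ U := by
  constructor
  · intro h
    refine ⟨Set.nonempty_coe_sort.1 h.nonempty, ?_⟩
    rintro U ⟨x, hxS, hxU⟩ hcl y hyS
    obtain ⟨p⟩ := h.preconnected ⟨x, hxS⟩ ⟨y, hyS⟩
    have key : ∀ {a b : S}, (G.induce S).Walk a b → (a : V) ∈ U → (b : V) ∈ U := by
      intro a b p
      induction p with
      | nil => exact id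
      | cons hadj _ ih => exact fun ha => ih (hcl _ (Subtype.prop _) ha _ (Subtype.prop _) hadj)
    exact key p hxU
  · rintro ⟨⟨x, hx⟩, h⟩
    rw [IsConnectedSet, SimpleGraph.connected_iff_exists_forall_reachable]
    refine ⟨⟨x, hx⟩, ?_⟩
    have := h {y | ∃ hy : y ∈ S, (G.induce S).Reachable ⟨x, hx⟩ ⟨y, hy⟩}
      ⟨x, hx, hx, SimpleGraph.Reachable.refl _⟩ ?_
    · rintro ⟨y, hy⟩
      exact (this hy).2
    · rintro a _ ⟨ha, hr⟩ b hb hab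
      exact ⟨hb, hr.trans (SimpleGraph.Adj.reachable (G := G.induce S) (u := ⟨a, ha⟩)
        (v := ⟨b, hb⟩) hab)⟩

theorem IsConnectedSet.nonempty {S : Set V} (h : IsConnectedSet G S) : S.Nonempty :=
  (isConnectedSet_iff.1 h).1

theorem IsConnectedSet.subset_of_closed {S U : Set V} (h : IsConnectedSet G S)
    (hU : (S ∩ U).Nonempty) (hcl : ∀ x ∈ S, x ∈ U → ∀ y ∈ S, G.Adj x y → y ∈ U) : S ⊆ U :=
  (isConnectedSet_iff.1 h).2 U hU hcl

theorem IsConnectedSet.exists_crossing {S U : Set V} (h : IsConnectedSet G S)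
    (hU : (S ∩ U).Nonempty) (hU' : (S \ U).Nonempty) :
    ∃ x ∈ S, x ∈ U ∧ ∃ y ∈ S, y ∉ U ∧ G.Adj x y := by
  by_contra! hcon
  obtain ⟨y, hy, hyU⟩ := hU'
  refine hyU (h.subset_of_closed hU (fun a ha haU b hb hab => ?_) hy)
  by_contra hbU
  exact hcon a ha haU b hb hbU hab

theorem isConnectedSet_singleton (x : V) : IsConnectedSet G {x} := by
  refine isConnectedSet_iff.2 ⟨⟨x, rfl⟩, ?_⟩
  rintro U ⟨y, rfl, hy⟩ - z rfl
  exact hy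

theorem isConnectedSet_univ (h : G.Connected) : IsConnectedSet G Set.univ := by
  refine isConnectedSet_iff.2 ⟨h.nonempty.elim fun x => ⟨x, trivial⟩, ?_⟩
  rintro U ⟨x, -, hx⟩ hcl y -
  obtain ⟨p⟩ := h.preconnected x y
  have key : ∀ {a b : V}, G.Walk a b → a ∈ U → b ∈ U := by
    intro a b p
    induction p with
    | nil => exact id
    | cons hadj _ ih => exact fun ha => ih (hcl _ trivial ha _ trivial hadj)
  exact key p hx

theorem connected_of_isConnectedSet_univ (h : IsConnectedSet G Set.univ) : G.Connected :=
  (SimpleGraph.induceUnivIso G).connected_iff.1 h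

theorem IsConnectedSet.union {S T : Set V} (hS : IsConnectedSet G S) (hT : IsConnectedSet G T)
    (h : (S ∩ T).Nonempty) : IsConnectedSet G (S ∪ T) := by
  refine isConnectedSet_iff.2 ⟨hS.nonempty.mono Set.subset_union_left, ?_⟩
  rintro U ⟨x, hx, hxU⟩ hcl
  have hcS := fun hU => hS.subset_of_closed (U := U) hU
    fun a ha haU b hb hab => hcl a (.inl ha) haU b (.inl hb) hab
  have hcT := fun hU => hT.subset_of_closed (U := U) hU
    fun a ha haU b hb hab => hcl a (.inr ha) haU b (.inr hb) hab
  obtain ⟨z, hzS, hzT⟩ := h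
  rcases hx with hx | hx
  · have h1 := hcS ⟨x, hx, hxU⟩
    exact Set.union_subset h1 (hcT ⟨z, hzT, h1 hzS⟩)
  · have h1 := hcT ⟨x, hx, hxU⟩
    exact Set.union_subset (hcS ⟨z, hzS, h1 hzT⟩) h1

theorem IsConnectedSet.union_of_adj {S T : Set V} (hS : IsConnectedSet G S)
    (hT : IsConnectedSet G T) {x y : V} (hx : x ∈ S) (hy : y ∈ T) (hxy : G.Adj x y) :
    IsConnectedSet G (S ∪ T) := by
  refine isConnectedSet_iff.2 ⟨hS.nonempty.mono Set.subset_union_left, ?_⟩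
  rintro U ⟨z, hz, hzU⟩ hcl
  have hcS := fun hU => hS.subset_of_closed (U := U) hU
    fun a ha haU b hb hab => hcl a (.inl ha) haU b (.inl hb) hab
  have hcT := fun hU => hT.subset_of_closed (U := U) hU
    fun a ha haU b hb hab => hcl a (.inr ha) haU b (.inr hb) hab
  rcases hz with hz | hz
  · have h1 := hcS ⟨z, hz, hzU⟩
    exact Set.union_subset h1 (hcT ⟨y, hy, hcl x (.inl hx) (h1 hx) y (.inr hy) hxy⟩)
  · have h1 := hcT ⟨z, hz, hzU⟩
    exact Set.union_subset (hcS ⟨x, hx, hcl y (.inr hy) (h1 hy) x (.inl hx) hxy.symm⟩) h1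

theorem isConnectedSet_pair {x y : V} (h : x = y ∨ G.Adj x y) : IsConnectedSet G {x, y} := by
  rcases h with rfl | h
  · simpa using isConnectedSet_singleton x
  · exact (isConnectedSet_singleton x).union_of_adj (isConnectedSet_singleton y) rfl rfl h

/-- A closed set that swallows one piece swallows the pieces at all neighbouring indices, and
connectedness of the index set spreads this. Connectedness of traces and of branch sets is reduced
to this. -/
theorem IsConnectedSet.biUnion {H : SimpleGraph ι} {S : Set ι} (hS : IsConnectedSet H S)
    {f : ι → Set V} (hf : ∀ i ∈ S, IsConnectedSet G (f i))
    (hadj : ∀ i ∈ S, ∀ j ∈ S, H.Adj i j → IsConnectedSet G (f i ∪ f j)) :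
    IsConnectedSet G (⋃ i ∈ S, f i) := by
  obtain ⟨i₀, hi₀⟩ := hS.nonempty
  refine isConnectedSet_iff.2 ⟨(hf i₀ hi₀).nonempty.mono (Set.subset_biUnion_of_mem hi₀), ?_⟩
  rintro U ⟨x, hx, hxU⟩ hcl
  obtain ⟨i, hi, hxi⟩ := Set.mem_iUnion₂.1 hx
  have hmem : ∀ i ∈ S, f i ⊆ ⋃ i ∈ S, f i := fun i hi => Set.subset_biUnion_of_mem hi
  have h0 : f i ⊆ U := (hf i hi).subset_of_closed ⟨x, hxi, hxU⟩
    fun a ha haU b hb hab => hcl a (hmem i hi ha) haU b (hmem i hi hb) hab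
  have : S ⊆ {i | f i ⊆ U} := by
    refine hS.subset_of_closed ⟨i, hi, h0⟩ fun a ha haU b hb hab => ?_
    refine Set.subset_union_right.trans ((hadj a ha b hb hab).subset_of_closed (U := U) ?_ ?_)
    · obtain ⟨z, hz⟩ := (hf a ha).nonempty
      exact ⟨z, .inl hz, haU hz⟩
    · have hs := Set.union_subset (hmem a ha) (hmem b hb)
      exact fun p hp hpU q hq hpq => hcl p (hs hp) hpU q (hs hq) hpq
  exact Set.iUnion₂_subset this

/-- Removing from a connected set a part that is attached at a single vertex. -/
theorem IsConnectedSet.sdiff {A R : Set V} (hA : IsConnectedSet G A) {b : V} (hb : b ∈ A)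
    (hbR : b ∉ R) (h : ∀ r ∈ R, ∀ y ∈ A, y ∉ R → G.Adj r y → y = b) :
    IsConnectedSet G (A \ R) := by
  refine isConnectedSet_iff.2 ⟨⟨b, hb, hbR⟩, ?_⟩
  rintro U ⟨x, ⟨hx, hxR⟩, hxU⟩ hcl
  -- If `b` were outside `U`, then `U \ R` would be closed in `A`: the only exit into or out of `R`
  -- is through `b`.
  have hbU : b ∈ U := by
    by_contra hbU
    have : A ⊆ U \ R := by
      refine hA.subset_of_closed ⟨x, hx, hxU, hxR⟩ fun p hp hpU y hy hpy => ?_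
      by_cases hyR : y ∈ R
      · exact absurd (h y hyR p hp hpU.2 hpy.symm ▸ hpU.1) hbU
      · exact ⟨hcl p ⟨hp, hpU.2⟩ hpU.1 y ⟨hy, hyR⟩ hpy, hyR⟩
    exact hbU (this hb).1
  have : A ⊆ U ∪ R := by
    refine hA.subset_of_closed ⟨x, hx, .inl hxU⟩ fun p hp hpU y hy hpy => ?_
    by_cases hyR : y ∈ R
    · exact .inr hyR
    by_cases hpR : p ∈ R
    · exact .inl (h p hpR y hy hyR hpy ▸ hbU)
    · exact .inl (hcl p ⟨hp, hpR⟩ (hpU.resolve_right hpR) y ⟨hy, hyR⟩ hpy)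
  exact fun y hy => (this hy.1).resolve_right hy.2

theorem IsConnectedSet.image {H : SimpleGraph ι} {S : Set ι} (hS : IsConnectedSet H S)
    (f : ι → V) (hf : ∀ i ∈ S, ∀ j ∈ S, H.Adj i j → f i = f j ∨ G.Adj (f i) (f j)) :
    IsConnectedSet G (f '' S) := by
  have := hS.biUnion (G := G) (f := fun i => {f i}) (fun i _ => isConnectedSet_singleton _)
    fun i hi j hj hij => isConnectedSet_pair (hf i hi j hj hij)
  rwa [← Set.image_eq_iUnion] at this

theorem IsConnectedSet.mono_graph {H : SimpleGraph V} {S : Set V} (hS : IsConnectedSet G S)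
    (h : ∀ x ∈ S, ∀ y ∈ S, G.Adj x y → H.Adj x y) : IsConnectedSet H S := by
  refine isConnectedSet_iff.2 ⟨hS.nonempty, fun U hU hcl => hS.subset_of_closed hU ?_⟩
  exact fun a ha haU b hb hab => hcl a ha haU b hb (h a ha b hb hab)

/-- The component of `v` in `G - X`; it is empty if `v ∈ X`. -/
def comp (G : SimpleGraph V) (X : Set V) (v : V) : Set V :=
  {w | ∃ A, IsConnectedSet G A ∧ v ∈ A ∧ w ∈ A ∧ Disjoint A X}

theorem comp_disjoint (X : Set V) (v : V) : Disjoint (comp G X v) X :=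
  Set.disjoint_left.2 fun _ ⟨_, _, _, hw, hA⟩ => Set.disjoint_left.1 hA hw

theorem mem_comp_self {X : Set V} {v : V} (h : v ∉ X) : v ∈ comp G X v :=
  ⟨{v}, isConnectedSet_singleton v, rfl, rfl, by simpa using h⟩

theorem subset_comp {X A : Set V} {v : V} (hA : IsConnectedSet G A) (hv : v ∈ A)
    (h : Disjoint A X) : A ⊆ comp G X v := fun _ hw => ⟨A, hA, hv, hw, h⟩

theorem comp_isConnectedSet {X : Set V} {v : V} (h : v ∉ X) : IsConnectedSet G (comp G X v) := by
  refine isConnectedSet_iff.2 ⟨⟨v, mem_comp_self h⟩, ?_⟩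
  rintro U ⟨x, ⟨A, hA, hv, hx, hAX⟩, hxU⟩ hcl y ⟨A', hA', hv', hy, hAX'⟩
  have hs := Set.union_subset (subset_comp hA hv hAX) (subset_comp hA' hv' hAX')
  exact (hA.union hA' ⟨v, hv, hv'⟩).subset_of_closed ⟨x, .inl hx, hxU⟩
    (fun a ha haU b hb hab => hcl a (hs ha) haU b (hs hb) hab) (.inr hy)

theorem comp_adj_mem {X : Set V} {v x y : V} (hx : x ∈ comp G X v) (hxy : G.Adj x y)
    (hy : y ∉ X) : y ∈ comp G X v := by
  obtain ⟨A, hA, hv, hx, hAX⟩ := hx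
  refine ⟨A ∪ {y}, hA.union_of_adj (isConnectedSet_singleton y) hx rfl hxy, .inl hv, .inr rfl, ?_⟩
  simpa [Set.disjoint_union_left] using And.intro hy hAX

theorem comp_eq_of_mem {X : Set V} {v w : V} (h : w ∈ comp G X v) : comp G X w = comp G X v := by
  obtain ⟨A, hA, hv, hw, hAX⟩ := h
  have key : ∀ {a b : V}, a ∈ A → b ∈ A → comp G X a ⊆ comp G X b := by
    rintro a b ha hb z ⟨A', hA', ha', hz, hAX'⟩
    exact ⟨A ∪ A', hA.union hA' ⟨a, ha, ha'⟩, .inl hb, .inr hz,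
      Set.disjoint_union_left.2 ⟨hAX, hAX'⟩⟩
  exact (key hw hv).antisymm (key hv hw)

/-- The bridge between the components of an induced subgraph, used to define separators, and `comp`,
which stays in `V` and avoids subtypes. -/
theorem reachable_induce_compl_iff {X : Set V} {v w : V} (hv : v ∈ Xᶜ) (hw : w ∈ Xᶜ) :
    (G.induce Xᶜ).Reachable ⟨v, hv⟩ ⟨w, hw⟩ ↔ w ∈ comp G X v := by
  constructor
  · rintro ⟨p⟩
    have key : ∀ {a b : (Xᶜ : Set V)}, (G.induce Xᶜ).Walk a b → (a : V) ∈ comp G X v →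
        (b : V) ∈ comp G X v := by
      intro a b p
      induction p with
      | nil => exact id
      | @cons a b c hadj _ ih => exact fun ha => ih (comp_adj_mem ha hadj b.2)
    exact key p (mem_comp_self hv)
  · rintro ⟨A, hA, hvA, hwA, hAX⟩
    have hle : A ⊆ Xᶜ := Set.subset_compl_iff_disjoint_right.2 hAX
    exact (hA.preconnected ⟨v, hvA⟩ ⟨w, hwA⟩).map (G.induceHomOfLE hle).toHom

theorem isSeparator_iff {x y : V} {S : Set V} :
    IsSeparator G x y S ↔ x ∉ S ∧ y ∉ S ∧ y ∉ comp G S x := by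
  constructor
  · rintro ⟨hx, hy, h⟩
    exact ⟨hx, hy, fun h' => h ((reachable_induce_compl_iff hx hy).2 h')⟩
  · rintro ⟨hx, hy, h⟩
    exact ⟨hx, hy, fun h' => h ((reachable_induce_compl_iff hx hy).1 h')⟩

end Connected

/-! ### Subtrees: sides of edges, the Helly property, contraction and gluing. -/

section Tree

variable {ι κ : Type*} {T : SimpleGraph ι}

/-- The vertices on the side of `a` of the edge `ta`. -/
def side (T : SimpleGraph ι) (t a : ι) : Set ι :=
  {s | (T.deleteEdges {s(t, a)}).Reachable a s}

theorem mem_side_self (T : SimpleGraph ι) (t a : ι) : a ∈ side T t a :=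
  SimpleGraph.Reachable.refl a

theorem notMem_side (hT : T.IsTree) {t a : ι} (h : T.Adj t a) : t ∉ side T t a := by
  have := SimpleGraph.isAcyclic_iff_forall_isBridge.1 hT.2 (T.mem_edgeSet.2 h)
  exact fun ht => SimpleGraph.isBridge_iff.1 this ht.symm

/-- Any edge other than `ta` survives the deletion and hence cannot leave the side. -/
theorem side_crossing (hT : T.IsTree) {t a x y : ι} (h : T.Adj t a) (hx : x ∈ side T t a)
    (hy : y ∉ side T t a) (hxy : T.Adj x y) : x = a ∧ y = t := by
  by_cases he : s(x, y) = s(t, a)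
  · rcases Sym2.eq_iff.1 he with ⟨rfl, rfl⟩ | ⟨rfl, rfl⟩
    · exact absurd hx (notMem_side hT h)
    · exact ⟨rfl, rfl⟩
  · refine absurd (SimpleGraph.Reachable.trans hx (SimpleGraph.Adj.reachable ?_)) hy
    simpa [SimpleGraph.deleteEdges_adj, hxy] using he

theorem univ_exists_crossing (hT : T.IsTree) {U : Set ι} {x y : ι} (hx : x ∈ U) (hy : y ∉ U) :
    ∃ x ∈ U, ∃ y, y ∉ U ∧ T.Adj x y := by
  obtain ⟨x, -, hx, y, -, hy, hxy⟩ := (isConnectedSet_univ hT.1).exists_crossing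
    (U := U) ⟨x, trivial, hx⟩ ⟨y, trivial, hy⟩
  exact ⟨x, hx, y, hy, hxy⟩

theorem exists_mem_side (hT : T.IsTree) {t s : ι} (h : s ≠ t) :
    ∃ a, T.Adj t a ∧ s ∈ side T t a := by
  by_contra! hcon
  obtain ⟨x, ⟨hxt, hx⟩, y, hy, hxy⟩ := univ_exists_crossing hT
    (U := {x | x ≠ t ∧ ∀ a, T.Adj t a → x ∉ side T t a}) (x := s) (y := t) ⟨h, hcon⟩ (by simp)
  simp only [Set.mem_ofPred_eq, not_and, not_forall, not_not] at hy
  by_cases hyt : y = t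
  · subst hyt
    exact hx x hxy.symm (mem_side_self _ _ _)
  · obtain ⟨a, ha, hya⟩ := hy hyt
    exact hxt (side_crossing hT ha hya (hx a ha) hxy.symm).2

theorem mem_side_or (hT : T.IsTree) {t a : ι} (h : T.Adj t a) (s : ι) :
    s ∈ side T t a ∨ s ∈ side T a t := by
  by_contra! hs
  obtain ⟨x, ⟨hx1, hx2⟩, y, hy, hxy⟩ := univ_exists_crossing hT
    (U := {x | x ∉ side T t a ∧ x ∉ side T a t}) (x := s) (y := t) hs
    (by simp [mem_side_self])
  by_cases hy1 : y ∈ side T t a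
  · have := (side_crossing hT h hy1 hx1 hxy.symm).2
    exact hx2 (this ▸ mem_side_self _ _ _)
  · have hy2 : y ∈ side T a t := by
      by_contra hy2
      exact hy ⟨hy1, hy2⟩
    have := (side_crossing hT h.symm hy2 hx2 hxy.symm).2
    exact hx1 (this ▸ mem_side_self _ _ _)

theorem notMem_of_no_crossing (hT : T.IsTree) {U : Set ι}
    (h : ∀ x ∈ U, ∀ y, y ∉ U → ¬ T.Adj x y) {z : ι} (hz : z ∉ U) (x : ι) : x ∉ U := by
  intro hx
  obtain ⟨x, hx, y, hy, hxy⟩ := univ_exists_crossing hT hx hz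
  exact h x hx y hy hxy

theorem notMem_side_symm (hT : T.IsTree) {t a s : ι} (h : T.Adj t a) (hs : s ∈ side T t a) :
    s ∉ side T a t := by
  refine fun hs' => notMem_of_no_crossing hT (U := side T t a ∩ side T a t) ?_
    (z := t) (fun ht => notMem_side hT h ht.1) s ⟨hs, hs'⟩
  rintro x ⟨hx1, hx2⟩ y hy hxy
  by_cases hy1 : y ∈ side T t a
  · have := (side_crossing hT h.symm hx2 (fun hy2 => hy ⟨hy1, hy2⟩) hxy).1
    exact notMem_side hT h (this ▸ hx1)
  · have := (side_crossing hT h hx1 hy1 hxy).1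
    exact notMem_side hT h.symm (this ▸ hx2)

theorem notMem_side_of_ne (hT : T.IsTree) {t a b s : ι} (ha : T.Adj t a) (hb : T.Adj t b)
    (hab : a ≠ b) (hs : s ∈ side T t a) : s ∉ side T t b := by
  have hba : ∀ {a b : ι}, T.Adj t a → T.Adj t b → a ≠ b → b ∉ side T t a := fun ha hb hab hm =>
    hab (side_crossing hT ha hm (notMem_side hT ha) hb.symm).1.symm
  refine fun hs' => notMem_of_no_crossing hT (U := side T t a ∩ side T t b) ?_
    (z := t) (fun ht => notMem_side hT ha ht.1) s ⟨hs, hs'⟩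
  rintro x ⟨hx1, hx2⟩ y hy hxy
  by_cases hy1 : y ∈ side T t a
  · have := (side_crossing hT hb hx2 (fun hy2 => hy ⟨hy1, hy2⟩) hxy).1
    exact hba ha hb hab (this ▸ hx1)
  · have := (side_crossing hT ha hx1 hy1 hxy).1
    exact hba hb ha hab.symm (this ▸ hx2)

theorem side_ssubset (hT : T.IsTree) {t a b : ι} (hta : T.Adj t a) (hab : T.Adj a b)
    (hbt : b ≠ t) : side T a b ⊂ side T t a := by
  refine ⟨fun x hx => ?_, fun h => notMem_side hT hab (h (mem_side_self _ _ _))⟩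
  exact (mem_side_or hT hta x).resolve_right (notMem_side_of_ne hT hab hta.symm hbt hx)

theorem side_eq_of_mem (hT : T.IsTree) {t a b s : ι} (ha : T.Adj t a) (hb : T.Adj t b)
    (hsa : s ∈ side T t a) (hsb : s ∈ side T t b) : a = b := by
  by_contra hab
  exact notMem_side_of_ne hT ha hb hab hsa hsb

/-- A connected set that contains `t` and a vertex on the side of `a` contains `a`. -/
theorem IsConnectedSet.mem_of_side (hT : T.IsTree) {A : Set ι} (hA : IsConnectedSet T A)
    {t a s : ι} (h : T.Adj t a) (hs : s ∈ side T t a) (hsA : s ∈ A) {u : ι} (hu : u ∉ side T t a)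
    (huA : u ∈ A) : a ∈ A ∧ t ∈ A := by
  obtain ⟨x, hxA, hx, y, hyA, hy, hxy⟩ := hA.exists_crossing (U := side T t a) ⟨s, hsA, hs⟩
    ⟨u, huA, hu⟩
  obtain ⟨rfl, rfl⟩ := side_crossing hT h hx hy hxy
  exact ⟨hxA, hyA⟩

theorem IsConnectedSet.subset_side (hT : T.IsTree) {A : Set ι} (hA : IsConnectedSet T A)
    {t : ι} (ht : t ∉ A) : ∃ a, T.Adj t a ∧ A ⊆ side T t a := by
  obtain ⟨s, hs⟩ := hA.nonempty
  obtain ⟨a, ha, hsa⟩ := exists_mem_side hT (t := t) (s := s) (fun h => ht (h ▸ hs))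
  refine ⟨a, ha, fun u hu => ?_⟩
  by_contra hua
  exact ht (hA.mem_of_side hT ha hsa hs hua hu).2

/-- If a closed part `W` missed a vertex `y` of the intersection, an edge leaving `W` towards `y`
would have its far end in every subtree, hence in `W`. The lemma provides hulls: the smallest
subtree that contains `s` and a given set. -/
theorem isConnectedSet_sInter (hT : T.IsTree) {F : Set (Set ι)} {s : ι} (hs : ∀ A ∈ F, s ∈ A)
    (hF : ∀ A ∈ F, IsConnectedSet T A) : IsConnectedSet T (⋂₀ F) := by
  refine isConnectedSet_iff.2 ⟨⟨s, hs⟩, ?_⟩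
  rintro U ⟨x, hx, hxU⟩ hcl y hy
  by_contra hyU
  have hcr : ∀ p ∈ ⋂₀ F ∩ U, ∀ q, q ∉ ⋂₀ F ∩ U → T.Adj p q → y ∉ side T p q := by
    rintro p ⟨hp, hpU⟩ q hq hpq hyq
    have hqF : q ∈ ⋂₀ F := fun A hA =>
      ((hF A hA).mem_of_side hT hpq hyq (hy A hA) (notMem_side hT hpq) (hp A hA)).1
    exact hq ⟨hqF, hcl p hp hpU q hqF hpq⟩
  -- The vertices outside `W = ⋂₀ F ∩ U` and beyond no edge leaving `W` include `y` but not `x`; an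
  -- edge crossing the border of this set is impossible.
  obtain ⟨z, ⟨hz, hz'⟩, w, hw, hzw⟩ := univ_exists_crossing hT
    (U := {z | z ∉ ⋂₀ F ∩ U ∧ ∀ p ∈ ⋂₀ F ∩ U, ∀ q, q ∉ ⋂₀ F ∩ U → T.Adj p q → z ∉ side T p q})
    (x := y) (y := x) ⟨fun h => hyU h.2, hcr⟩ (fun h => h.1 ⟨hx, hxU⟩)
  have hw1 : w ∉ ⋂₀ F ∩ U := fun hw => hz' w hw z hz hzw.symm (mem_side_self _ _ _)
  refine hw ⟨hw1, fun p hp q hq hpq hwq => ?_⟩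
  have := (side_crossing hT hpq hwq (hz' p hp q hq hpq) hzw.symm).2
  exact hz (this ▸ hp)

/-- The Helly property of subtrees. -/
theorem exists_mem_of_pairwise_inter [Finite ι] (hT : T.IsTree) {F : Set (Set ι)}
    (hF : ∀ A ∈ F, IsConnectedSet T A) (hI : ∀ A ∈ F, ∀ B ∈ F, (A ∩ B).Nonempty) :
    ∃ t, ∀ A ∈ F, t ∈ A := by
  by_contra! hcon
  have hex : ∀ t, ∃ a, T.Adj t a ∧ ∃ A ∈ F, A ⊆ side T t a := by
    intro t
    obtain ⟨A, hA, htA⟩ := hcon t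
    obtain ⟨a, ha, h⟩ := (hF A hA).subset_side hT htA
    exact ⟨a, ha, A, hA, h⟩
  obtain ⟨t₀⟩ := hT.1.nonempty
  -- Each node points towards a member that it misses. Take an arrow with the smallest side: the
  -- arrow at its head cannot point back, since the two members intersect, so its side is strictly
  -- smaller.
  obtain ⟨⟨t, a⟩, ⟨hta, A, hA, hAs⟩, hmin⟩ := Set.exists_min_image
    {p : ι × ι | T.Adj p.1 p.2 ∧ ∃ A ∈ F, A ⊆ side T p.1 p.2}
    (fun p => (side T p.1 p.2).ncard) (Set.toFinite _)
    (let ⟨a, h⟩ := hex t₀; ⟨(t₀, a), h⟩)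
  obtain ⟨b, hab, B, hB, hBs⟩ := hex a
  obtain ⟨z, hzA, hzB⟩ := hI A hA B hB
  have hbt : b ≠ t := by
    rintro rfl
    exact notMem_side_symm hT hta (hAs hzA) (hBs hzB)
  exact absurd (hmin (a, b) ⟨hab, B, hB, hBs⟩)
    (not_le.2 (Set.ncard_lt_ncard (side_ssubset hT hta hab hbt)))

/-- Two disjoint subtrees without an edge between them are separated by a vertex. -/
theorem exists_separating_vertex [Finite ι] (hT : T.IsTree) {A B : Set ι}
    (hA : IsConnectedSet T A) (hB : IsConnectedSet T B) (hAB : Disjoint A B)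
    (hadj : ∀ a ∈ A, ∀ b ∈ B, ¬ T.Adj a b) :
    ∃ t a b, T.Adj t a ∧ T.Adj t b ∧ a ≠ b ∧ a ∈ A ∧ A ⊆ side T t a ∧ B ⊆ side T t b := by
  have hex : ∀ a ∉ B, ∃ c, T.Adj a c ∧ B ⊆ side T a c := fun a ha => hB.subset_side hT ha
  obtain ⟨a₀, ha₀⟩ := hA.nonempty
  -- The last exit from `A` towards `B`: minimality of the side keeps `t` out of `A`, and
  -- nonadjacency keeps it out of `B`.
  obtain ⟨⟨a, t⟩, ⟨ha, hat, hBt⟩, hmin⟩ := Set.exists_min_image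
    {p : ι × ι | p.1 ∈ A ∧ T.Adj p.1 p.2 ∧ B ⊆ side T p.1 p.2}
    (fun p => (side T p.1 p.2).ncard) (Set.toFinite _)
    (let ⟨c, h⟩ := hex a₀ (Set.disjoint_left.1 hAB ha₀); ⟨(a₀, c), ha₀, h⟩)
  dsimp only at ha hat hBt
  have htB : t ∉ B := fun h => hadj a ha t h hat
  obtain ⟨b, htb, hBb⟩ := hex t htB
  obtain ⟨z, hz⟩ := hB.nonempty
  have hba : b ≠ a := by
    rintro rfl
    exact notMem_side_symm hT hat (hBt hz) (hBb hz)
  have htA : t ∉ A := fun h => absurd (hmin (t, b) ⟨h, htb, hBb⟩)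
    (not_le.2 (Set.ncard_lt_ncard (side_ssubset hT hat htb hba)))
  obtain ⟨a', hta', hA'⟩ := hA.subset_side hT htA
  obtain rfl := side_eq_of_mem hT hta' hat.symm (hA' ha) (mem_side_self _ _ _)
  exact ⟨t, a', b, hta', htb, hba.symm, ha, hA', hBb⟩

theorem isTree_of_connected_of_card_le [Finite ι] (h : T.Connected)
    (hc : T.edgeSet.ncard + 1 ≤ Nat.card ι) : T.IsTree := by
  refine SimpleGraph.isTree_iff_connected_and_card.2 ⟨h, le_antisymm ?_ ?_⟩
  · rwa [Nat.card_coe_set_eq]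
  · exact h.card_vert_le_card_edgeSet_add_one

theorem ncard_edgeSet_add_one [Finite ι] (hT : T.IsTree) : T.edgeSet.ncard + 1 = Nat.card ι := by
  rw [← Nat.card_coe_set_eq]
  exact (SimpleGraph.isTree_iff_connected_and_card.1 hT).2

/-- The graph on `κ` obtained from `T` by identifying vertices along `f`. -/
def identify (T : SimpleGraph ι) (f : ι → κ) : SimpleGraph κ :=
  SimpleGraph.fromRel fun x y => ∃ a b, f a = x ∧ f b = y ∧ T.Adj a b

theorem identify_adj {f : ι → κ} {x y : κ} :
    (identify T f).Adj x y ↔ x ≠ y ∧ ∃ a b, f a = x ∧ f b = y ∧ T.Adj a b := by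
  simp only [identify, SimpleGraph.fromRel_adj]
  constructor
  · rintro ⟨h, h' | ⟨a, b, ha, hb, hab⟩⟩
    · exact ⟨h, h'⟩
    · exact ⟨h, b, a, hb, ha, hab.symm⟩
  · exact fun h => ⟨h.1, .inl h.2⟩

theorem identify_adj_map {f : ι → κ} {a b : ι} (h : T.Adj a b) :
    f a = f b ∨ (identify T f).Adj (f a) (f b) :=
  or_iff_not_imp_left.2 fun hne => identify_adj.2 ⟨hne, a, b, rfl, rfl, h⟩

theorem isConnectedSet_identify_image {f : ι → κ} {A : Set ι} (hA : IsConnectedSet T A) :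
    IsConnectedSet (identify T f) (f '' A) :=
  hA.image f fun _ _ _ _ h => identify_adj_map h

/-- Contracting an edge of a tree gives a tree. -/
theorem identify_isTree [Finite ι] (hT : T.IsTree) {f : ι → κ} (hf : f.Surjective) {t a : ι}
    (hta : T.Adj t a) (hfta : f t = f a) (hc : Nat.card ι ≤ Nat.card κ + 1) :
    (identify T f).IsTree := by
  have : Finite κ := Finite.of_surjective f hf
  refine isTree_of_connected_of_card_le (connected_of_isConnectedSet_univ ?_) ?_
  · have := isConnectedSet_identify_image (f := f) (isConnectedSet_univ hT.1)
    rwa [Set.image_univ, hf.range_eq] at this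
  · have hsub : (identify T f).edgeSet ⊆ Sym2.map f '' (T.edgeSet \ {s(t, a)}) := by
      intro e
      induction e with | _ x y
      intro h
      obtain ⟨hne, b, c, rfl, rfl, hbc⟩ := identify_adj.1 (SimpleGraph.mem_edgeSet _ |>.1 h)
      refine ⟨s(b, c), ⟨hbc, fun he => hne ?_⟩, rfl⟩
      rcases Sym2.eq_iff.1 he with ⟨rfl, rfl⟩ | ⟨rfl, rfl⟩
      · exact hfta
      · exact hfta.symm
    have h1 := (Set.ncard_le_ncard hsub (Set.toFinite _)).trans
      (Set.ncard_image_le (Set.toFinite _))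
    have h2 := Set.ncard_sdiff_singleton_add_one (s := T.edgeSet) (T.mem_edgeSet.2 hta)
    have h3 := ncard_edgeSet_add_one hT
    omega

open Classical in
/-- Contracting the edge `qc` of a tree into `c`. -/
theorem exists_contraction [Finite ι] (hT : T.IsTree) {q c : ι} (hqc : T.Adj q c) :
    ∃ T' : SimpleGraph {s // s ≠ q}, T'.IsTree ∧
      (∀ s s' : {s // s ≠ q}, T.Adj s s' → T'.Adj s s') ∧
      (∀ s s' : {s // s ≠ q}, s.1 = c → T.Adj q s' → s' ≠ s → T'.Adj s s') ∧
      ∀ A : Set ι, IsConnectedSet T A → (q ∈ A → c ∈ A) →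
        IsConnectedSet T' (Subtype.val ⁻¹' A) := by
  let f : ι → {s // s ≠ q} := fun s => if h : s = q then ⟨c, hqc.ne.symm⟩ else ⟨s, h⟩
  have hfs : ∀ s : {s // s ≠ q}, f s = s := fun s => dif_neg s.2
  have hfq : f q = ⟨c, hqc.ne.symm⟩ := dif_pos rfl
  refine ⟨identify T f, identify_isTree hT (fun s => ⟨s, hfs s⟩) hqc ?_ ?_, ?_, ?_, ?_⟩
  · rw [hfq, ← hfs ⟨c, hqc.ne.symm⟩]
  · have h1 := Set.ncard_add_ncard_compl ({q} : Set ι)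
    rw [Set.ncard_singleton] at h1
    have h2 : ({q}ᶜ : Set ι).ncard = Nat.card {s // s ≠ q} := (Nat.card_coe_set_eq _).symm
    omega
  · intro s s' h
    exact identify_adj.2 ⟨fun he => h.ne (congrArg Subtype.val he), s, s', hfs s, hfs s', h⟩
  · rintro ⟨s, hs⟩ s' rfl h hne
    exact identify_adj.2 ⟨hne.symm, q, s', hfq, hfs s', h⟩
  · intro A hA hqA
    convert isConnectedSet_identify_image (f := f) hA using 1
    ext s
    constructor
    · exact fun hs => ⟨s, hs, hfs s⟩
    · rintro ⟨a, ha, rfl⟩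
      by_cases haq : a = q
      · subst haq
        simpa [hfq] using hqA ha
      · have := hfs ⟨a, haq⟩
        simpa [this] using ha

/-- The disjoint union of two graphs with an additional edge joining `r` and `r'`. -/
def glue (T : SimpleGraph ι) (T' : SimpleGraph κ) (r : ι) (r' : κ) : SimpleGraph (ι ⊕ κ) :=
  SimpleGraph.fromRel fun x y => (∃ a b, T.Adj a b ∧ x = .inl a ∧ y = .inl b) ∨
    (∃ a b, T'.Adj a b ∧ x = .inr a ∧ y = .inr b) ∨ (x = .inl r ∧ y = .inr r')

theorem glue_inl {T' : SimpleGraph κ} {r : ι} {r' : κ} {a b : ι} (h : T.Adj a b) :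
    (glue T T' r r').Adj (.inl a) (.inl b) := by
  simp [glue, h, h.ne]

theorem glue_inr {T' : SimpleGraph κ} {r : ι} {r' : κ} {a b : κ} (h : T'.Adj a b) :
    (glue T T' r r').Adj (.inr a) (.inr b) := by
  simp [glue, h, h.ne]

theorem glue_root {T' : SimpleGraph κ} {r : ι} {r' : κ} :
    (glue T T' r r').Adj (.inl r) (.inr r') := by
  simp [glue]

theorem glue_isTree [Finite ι] [Finite κ] {T' : SimpleGraph κ} (hT : T.IsTree) (hT' : T'.IsTree)
    (r : ι) (r' : κ) : (glue T T' r r').IsTree := by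
  refine isTree_of_connected_of_card_le (connected_of_isConnectedSet_univ ?_) ?_
  · have h1 := (isConnectedSet_univ hT.1).image (G := glue T T' r r') Sum.inl
      fun _ _ _ _ h => .inr (glue_inl h)
    have h2 := (isConnectedSet_univ hT'.1).image (G := glue T T' r r') Sum.inr
      fun _ _ _ _ h => .inr (glue_inr h)
    have := h1.union_of_adj h2 ⟨r, trivial, rfl⟩ ⟨r', trivial, rfl⟩ glue_root
    rwa [Set.image_univ, Set.image_univ, Set.range_inl_union_range_inr] at this
  · have hsub : (glue T T' r r').edgeSet ⊆ insert s(.inl r, .inr r')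
        (Sym2.map Sum.inl '' T.edgeSet ∪ Sym2.map Sum.inr '' T'.edgeSet) := by
      intro e
      induction e with | _ x y
      intro h
      rw [SimpleGraph.mem_edgeSet, glue, SimpleGraph.fromRel_adj] at h
      rcases h with ⟨-, (⟨a, b, h, rfl, rfl⟩ | ⟨a, b, h, rfl, rfl⟩ | ⟨rfl, rfl⟩) |
        (⟨a, b, h, rfl, rfl⟩ | ⟨a, b, h, rfl, rfl⟩ | ⟨rfl, rfl⟩)⟩
      · exact .inr (.inl ⟨s(a, b), h, rfl⟩)
      · exact .inr (.inr ⟨s(a, b), h, rfl⟩)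
      · exact .inl rfl
      · exact .inr (.inl ⟨s(b, a), h.symm, rfl⟩)
      · exact .inr (.inr ⟨s(b, a), h.symm, rfl⟩)
      · exact .inl Sym2.eq_swap
    have h1 := (Set.ncard_le_ncard hsub (Set.toFinite _)).trans (Set.ncard_insert_le _ _)
    have h2 := Set.ncard_union_le (Sym2.map (Sum.inl (β := κ)) '' T.edgeSet)
      (Sym2.map (Sum.inr (α := ι)) '' T'.edgeSet)
    have h3 := Set.ncard_image_le (f := Sym2.map (Sum.inl (β := κ))) (Set.toFinite T.edgeSet)
    have h4 := Set.ncard_image_le (f := Sym2.map (Sum.inr (α := ι))) (Set.toFinite T'.edgeSet)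
    have h5 := ncard_edgeSet_add_one hT
    have h6 := ncard_edgeSet_add_one hT'
    rw [Nat.card_sum]
    omega

end Tree

/-! ### Traces, minor models and the order of a bramble. -/

section Decompositions

variable {V ι : Type*} {G : SimpleGraph V}

theorem width_le_iff [Finite ι] {χ : ι → Set V} {k : ℕ} :
    width χ ≤ k ↔ ∀ t, (χ t).ncard ≤ k :=
  ⟨fun h t => (le_ciSup (Set.finite_range fun t => (χ t).ncard).bddAbove t).trans h,
    fun h => ciSup_le' h⟩

/-- Adjacent vertices need not share a bag, but their traces meet or are joined by a tree edge,
which is enough to connect the union of the traces. -/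
theorem IsLenientTreeDecomposition.trace_isConnectedSet {T : SimpleGraph ι} {χ : ι → Set V}
    (h : IsLenientTreeDecomposition G T χ) {S : Set V} (hS : IsConnectedSet G S) :
    IsConnectedSet T {t | (χ t ∩ S).Nonempty} := by
  have heq : {t | (χ t ∩ S).Nonempty} = ⋃ x ∈ S, {t | x ∈ χ t} := by
    ext t
    simp [Set.Nonempty, and_comm]
  rw [heq]
  refine hS.biUnion (fun x _ => h.trace x) fun x _ y _ hxy => ?_
  obtain ⟨t, t', htt, hx, hy⟩ := h.edge x y hxy
  have hpair := isConnectedSet_pair htt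
  have hne : ∀ {z}, z ∈ χ t ∪ χ t' → ({z' | z ∈ χ z'} ∩ {t, t'}).Nonempty := by
    rintro z (hz | hz)
    · exact ⟨t, hz, by simp⟩
    · exact ⟨t', hz, by simp⟩
  have h1 := (h.trace x).union hpair (hne hx)
  by_cases hsame : ({t | x ∈ χ t} ∩ {t | y ∈ χ t}).Nonempty
  · exact (h.trace x).union (h.trace y) hsame
  · rcases hx with hx | hx <;> rcases hy with hy | hy
    · exact absurd ⟨t, hx, hy⟩ hsame
    · exact (h.trace x).union_of_adj (h.trace y) hx hy
        (htt.resolve_left fun he => hsame ⟨t, hx, he ▸ hy⟩)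
    · exact (h.trace x).union_of_adj (h.trace y) hx hy
        (htt.resolve_left fun he => hsame ⟨t, he ▸ hx, hy⟩).symm
    · exact absurd ⟨t', hx, hy⟩ hsame

/-- Branch sets project to connected sets of the tree. A bag has at most `k` vertices because
disjoint branch sets use different vertices of the fibre. -/
theorem exists_lenientTreeDecomposition_of_minor {T : SimpleGraph ι} (hT : T.IsTree) {k : ℕ}
    (h : IsMinor G (lexProduct T (⊤ : SimpleGraph (Fin k)))) :
    ∃ χ : ι → Set V, IsLenientTreeDecomposition G T χ ∧ ∀ t, (χ t).ncard ≤ k := by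
  obtain ⟨μ, hμ⟩ := h
  refine ⟨fun t => {v | ∃ i, (t, i) ∈ μ v}, ⟨hT, ?_, ?_, ?_⟩, ?_⟩
  · refine Set.eq_univ_of_forall fun v => ?_
    obtain ⟨⟨t, i⟩, h⟩ := (hμ.connected v).nonempty
    exact Set.mem_iUnion.2 ⟨t, i, h⟩
  · intro x y hxy
    obtain ⟨⟨t, i⟩, hx, ⟨t', j⟩, hy, h⟩ := hμ.adj x y hxy
    exact ⟨t, t', (Or.symm h).imp (fun h => h.1) id, .inl ⟨i, hx⟩, .inr ⟨j, hy⟩⟩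
  · intro x
    have := (hμ.connected x).image (G := T) Prod.fst fun p _ q _ h =>
      (Or.symm h).imp (fun h => h.1) id
    convert this using 1
    ext t
    simp
  · intro t
    have hex : ∀ v, ∃ i : Fin k, (∃ i, (t, i) ∈ μ v) → (t, i) ∈ μ v := by
      intro v
      by_cases hv : ∃ i, (t, i) ∈ μ v
      · exact ⟨hv.choose, fun _ => hv.choose_spec⟩
      -- A default index for vertices outside the bag; `Fin k` is inhabited because branch sets are
      -- nonempty.
      · by_cases hk : Nonempty (Fin k)
        · exact ⟨hk.some, fun h => absurd h hv⟩
        · obtain ⟨⟨t', i⟩, h⟩ := (hμ.connected v).nonempty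
          exact absurd ⟨i⟩ hk
    choose f hf using hex
    have := Set.ncard_le_ncard_of_injOn (s := {v | ∃ i, (t, i) ∈ μ v}) (t := Set.univ) f
      (fun _ _ => trivial) (fun v hv w hw he => ?_) Set.finite_univ
    · simpa [Set.ncard_univ] using this
    · by_contra hne
      have h1 := hf v hv
      rw [he] at h1
      exact Set.disjoint_left.1 (hμ.disjoint v w hne) h1 (hf w hw)

/-- Number each bag injectively; the branch set of `v` consists of its numbers over its trace. The
numbers at adjacent nodes need not agree, since the product joins whole fibres. -/
theorem isMinor_of_lenientTreeDecomposition [Finite V] {T : SimpleGraph ι} {χ : ι → Set V} {k : ℕ}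
    (h : IsLenientTreeDecomposition G T χ) (hk : ∀ t, (χ t).ncard ≤ k) :
    IsMinor G (lexProduct T (⊤ : SimpleGraph (Fin k))) := by
  have hex : ∀ t, ∃ f : χ t → Fin k, f.Injective := by
    intro t
    have := Fintype.ofFinite (χ t)
    have hc : Fintype.card (χ t) ≤ Fintype.card (Fin k) := by
      rw [Fintype.card_fin, ← Nat.card_eq_fintype_card, Nat.card_coe_set_eq]
      exact hk t
    obtain ⟨e⟩ := Function.Embedding.nonempty_of_card_le hc
    exact ⟨e, e.injective⟩
  choose f hf using hex
  refine ⟨fun v => {p | ∃ hv : v ∈ χ p.1, f p.1 ⟨v, hv⟩ = p.2}, ⟨?_, ?_, ?_⟩⟩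
  · intro v
    have hb := (h.trace v).biUnion (G := lexProduct T (⊤ : SimpleGraph (Fin k)))
      (f := fun t => {p | p.1 = t ∧ ∃ hv : v ∈ χ p.1, f p.1 ⟨v, hv⟩ = p.2}) ?_ ?_
    · convert hb using 1
      ext ⟨t, i⟩
      simp only [Set.mem_iUnion, Set.mem_ofPred_eq]
      constructor
      · rintro ⟨hv, he⟩
        exact ⟨t, hv, rfl, hv, he⟩
      · rintro ⟨_, _, -, h⟩
        exact h
    · intro t ht
      convert isConnectedSet_singleton (G := lexProduct T (⊤ : SimpleGraph (Fin k)))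
        (t, f t ⟨v, ht⟩) using 1
      ext ⟨t', i⟩
      simp only [Set.mem_ofPred_eq, Set.mem_singleton_iff, Prod.mk.injEq]
      constructor
      · rintro ⟨rfl, hv, he⟩
        exact ⟨rfl, he.symm⟩
      · rintro ⟨rfl, rfl⟩
        exact ⟨rfl, ht, rfl⟩
    · intro t ht t' ht' htt
      convert isConnectedSet_pair (G := lexProduct T (⊤ : SimpleGraph (Fin k)))
        (x := (t, f t ⟨v, ht⟩)) (y := (t', f t' ⟨v, ht'⟩)) (.inr (.inl htt)) using 1
      ext ⟨s, i⟩
      simp only [Set.mem_union, Set.mem_ofPred_eq, Set.mem_insert_iff, Set.mem_singleton_iff,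
        Prod.mk.injEq]
      constructor
      · rintro (⟨rfl, hv, he⟩ | ⟨rfl, hv, he⟩)
        · exact .inl ⟨rfl, he.symm⟩
        · exact .inr ⟨rfl, he.symm⟩
      · rintro (⟨rfl, rfl⟩ | ⟨rfl, rfl⟩)
        · exact .inl ⟨rfl, ht, rfl⟩
        · exact .inr ⟨rfl, ht', rfl⟩
  · intro u v huv
    rw [Set.disjoint_left]
    rintro ⟨t, i⟩ ⟨hu, he⟩ ⟨hv, he'⟩
    exact huv (congrArg Subtype.val (hf t (he.trans he'.symm)))
  · intro u v huv
    obtain ⟨t, t', htt, hu, hv⟩ := h.edge u v huv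
    obtain ⟨s, s', hss, hu, hv⟩ : ∃ s s', (s = s' ∨ T.Adj s s') ∧ u ∈ χ s ∧ v ∈ χ s' := by
      rcases hu with hu | hu <;> rcases hv with hv | hv
      · exact ⟨t, t, .inl rfl, hu, hv⟩
      · exact ⟨t, t', htt, hu, hv⟩
      · exact ⟨t', t, htt.imp Eq.symm fun h => h.symm, hu, hv⟩
      · exact ⟨t', t', .inl rfl, hu, hv⟩
    refine ⟨(s, f s ⟨u, hu⟩), ⟨hu, rfl⟩, (s', f s' ⟨v, hv⟩), ⟨hv, rfl⟩, ?_⟩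
    rcases hss with rfl | hss
    · exact .inr ⟨rfl, fun he => huv.ne (congrArg Subtype.val (hf s he))⟩
    · exact .inl hss

theorem covers_univ {B : Set (Set V)} (hB : IsStrictBramble G B) : Covers Set.univ B := by
  intro S hS
  simpa using (hB.connected S hS).nonempty

theorem lt_order_iff {B : Set (Set V)} (hB : IsStrictBramble G B) {k : ℕ} :
    k < order B ↔ ∀ X, Covers X B → k < X.ncard := by
  constructor
  · intro h X hX
    exact h.trans_le (Nat.sInf_le ⟨X, hX, rfl⟩)
  · intro h
    obtain ⟨X, hX, he⟩ := Nat.sInf_mem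
      (s := {n : ℕ | ∃ X : Set V, Covers X B ∧ X.ncard = n}) ⟨_, _, covers_univ hB, rfl⟩
    exact (h X hX).trans_eq he

end Decompositions

/-! ### Duality: from the absence of strict brambles to a decomposition. -/

section Duality

variable {V : Type*} {G : SimpleGraph V}

/-- `G[U]` has a lenient tree decomposition with bag `X` at some vertex, all of whose bags
satisfy `P`. -/
def HasRootedDecomposition (G : SimpleGraph V) (P : Set V → Prop) (X U : Set V) : Prop :=
  ∃ (ι : Type) (_ : Finite ι) (T : SimpleGraph ι) (χ : ι → Set V) (r : ι), T.IsTree ∧ χ r = X ∧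
    (∀ t, χ t ⊆ U) ∧
    (∀ x ∈ U, ∀ y ∈ U, G.Adj x y →
      ∃ t t', (t = t' ∨ T.Adj t t') ∧ x ∈ χ t ∪ χ t' ∧ y ∈ χ t ∪ χ t') ∧
    (∀ x ∈ U, IsConnectedSet T {t | x ∈ χ t}) ∧ ∀ t, P (χ t)

theorem hasRootedDecomposition_self {P : Set V → Prop} {X : Set V} (hX : P X) :
    HasRootedDecomposition G P X X := by
  refine ⟨Unit, inferInstance, ⊥, fun _ => X, (), SimpleGraph.IsTree.of_subsingleton, rfl,
    fun _ => subset_rfl, fun x hx y hy _ => ⟨(), (), .inl rfl, .inl hx, .inl hy⟩, fun x hx => ?_,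
    fun _ => hX⟩
  convert isConnectedSet_singleton ()
  ext
  simpa using hx

/-- Join the two nodes with bag `X` by a tree edge. Only vertices of `X` occur on both sides, and
their traces are connected by this edge. -/
theorem HasRootedDecomposition.union {P : Set V → Prop} {X U U' : Set V}
    (h : HasRootedDecomposition G P X U) (h' : HasRootedDecomposition G P X U')
    (hi : U ∩ U' = X) (hadj : ∀ x ∈ U, ∀ y ∈ U', G.Adj x y → x ∈ X ∨ y ∈ X) :
    HasRootedDecomposition G P X (U ∪ U') := by
  obtain ⟨ι, _, T, χ, r, hT, hr, hU, hE, hC, hP⟩ := h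
  obtain ⟨κ, _, T', χ', r', hT', hr', hU', hE', hC', hP'⟩ := h'
  have hXU : X ⊆ U := hi ▸ Set.inter_subset_left
  have hXU' : X ⊆ U' := hi ▸ Set.inter_subset_right
  have hEl : ∀ x ∈ U, ∀ y ∈ U, G.Adj x y → ∃ t t', (t = t' ∨ (glue T T' r r').Adj t t') ∧
      x ∈ Sum.elim χ χ' t ∪ Sum.elim χ χ' t' ∧ y ∈ Sum.elim χ χ' t ∪ Sum.elim χ χ' t' := by
    intro x hx y hy hxy
    obtain ⟨t, t', htt, h⟩ := hE x hx y hy hxy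
    exact ⟨.inl t, .inl t', htt.imp (congrArg _) glue_inl, h⟩
  have hEr : ∀ x ∈ U', ∀ y ∈ U', G.Adj x y → ∃ t t', (t = t' ∨ (glue T T' r r').Adj t t') ∧
      x ∈ Sum.elim χ χ' t ∪ Sum.elim χ χ' t' ∧ y ∈ Sum.elim χ χ' t ∪ Sum.elim χ χ' t' := by
    intro x hx y hy hxy
    obtain ⟨t, t', htt, h⟩ := hE' x hx y hy hxy
    exact ⟨.inr t, .inr t', htt.imp (congrArg _) glue_inr, h⟩
  have htr : ∀ x, {t | x ∈ Sum.elim χ χ' t} = Sum.inl '' {t | x ∈ χ t} ∪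
      Sum.inr '' {t | x ∈ χ' t} := by
    intro x
    ext (t | t) <;> simp
  refine ⟨ι ⊕ κ, inferInstance, glue T T' r r', Sum.elim χ χ', .inl r, glue_isTree hT hT' r r',
    hr, ?_, ?_, ?_, ?_⟩
  · rintro (t | t)
    · exact (hU t).trans Set.subset_union_left
    · exact (hU' t).trans Set.subset_union_right
  · rintro x (hx | hx) y (hy | hy) hxy
    · exact hEl x hx y hy hxy
    · rcases hadj x hx y hy hxy with h | h
      · exact hEr x (hXU' h) y hy hxy
      · exact hEl x hx y (hXU h) hxy
    · rcases hadj y hy x hx hxy.symm with h | h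
      · exact hEr x hx y (hXU' h) hxy
      · exact hEl x (hXU h) y hy hxy
    · exact hEr x hx y hy hxy
  · intro x hx
    rw [htr]
    have hl : x ∈ U → IsConnectedSet (glue T T' r r') (Sum.inl '' {t | x ∈ χ t}) := fun hx =>
      (hC x hx).image _ fun _ _ _ _ h => .inr (glue_inl h)
    have hr1 : x ∈ U' → IsConnectedSet (glue T T' r r') (Sum.inr '' {t | x ∈ χ' t}) := fun hx =>
      (hC' x hx).image _ fun _ _ _ _ h => .inr (glue_inr h)
    by_cases h1 : x ∈ U <;> by_cases h2 : x ∈ U'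
    · have hxX : x ∈ X := hi ▸ ⟨h1, h2⟩
      have hxr : x ∈ χ r := hr.symm ▸ hxX
      have hxr' : x ∈ χ' r' := hr'.symm ▸ hxX
      exact (hl h1).union_of_adj (hr1 h2) ⟨r, hxr, rfl⟩ ⟨r', hxr', rfl⟩ glue_root
    · have : {t | x ∈ χ' t} = ∅ := Set.eq_empty_of_forall_notMem fun t ht => h2 (hU' t ht)
      simpa [this] using hl h1
    · have : {t | x ∈ χ t} = ∅ := Set.eq_empty_of_forall_notMem fun t ht => h1 (hU t ht)
      simpa [this] using hr1 h2
    · exact absurd hx (by simp [h1, h2])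
  · rintro (t | t)
    · exact hP t
    · exact hP' t

/-- The components are added one vertex at a time; a vertex in `X` or in a component already present
contributes nothing new. -/
theorem HasRootedDecomposition.of_comps [Finite V] {P : Set V → Prop} {X : Set V} (hX : P X)
    (h : ∀ v, v ∉ X → HasRootedDecomposition G P X (X ∪ comp G X v)) :
    HasRootedDecomposition G P X Set.univ := by
  have key : ∀ F : Set V, F.Finite → HasRootedDecomposition G P X (X ∪ ⋃ v ∈ F, comp G X v) := by
    intro F hF
    induction F, hF using Set.Finite.induction_on with
    | empty => simpa using hasRootedDecomposition_self hX
    | @insert v F _ _ ih =>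
      rw [Set.biUnion_insert]
      by_cases hv : v ∈ X
      · have : comp G X v = ∅ := Set.eq_empty_of_forall_notMem
          fun w ⟨A, _, hvA, _, hAX⟩ => Set.disjoint_left.1 hAX hvA hv
        simpa [this] using ih
      by_cases hex : ∃ w ∈ F, v ∈ comp G X w
      · obtain ⟨w, hw, hvw⟩ := hex
        have : comp G X v ⊆ ⋃ v ∈ F, comp G X v :=
          (comp_eq_of_mem hvw).le.trans (Set.subset_biUnion_of_mem (u := fun v => comp G X v) hw)
        rwa [Set.union_eq_self_of_subset_left this]
      · have hdis : ∀ x ∈ comp G X v, ∀ w ∈ F, x ∉ comp G X w := fun x hx w hw hxw =>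
          hex ⟨w, hw, by
            rw [← comp_eq_of_mem hxw, comp_eq_of_mem hx]
            exact mem_comp_self hv⟩
        have := (h v hv).union ih ?_ ?_
        · rwa [← Set.union_union_distrib_left] at this
        · ext x
          simp only [Set.mem_inter_iff, Set.mem_union, Set.mem_iUnion]
          constructor
          · rintro ⟨h1 | h1, h2 | ⟨w, hw, h2⟩⟩
            · exact h1
            · exact h1
            · exact h2
            · exact absurd h2 (hdis x h1 w hw)
          · exact fun hx => ⟨.inl hx, .inl hx⟩
        · rintro x (hx | hx) y (hy | hy) hxy
          · exact .inl hx
          · exact .inl hx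
          · exact .inr hy
          · by_cases hyX : y ∈ X
            · exact .inr hyX
            · obtain ⟨w, hw, hyw⟩ := Set.mem_iUnion₂.1 hy
              exact absurd hyw (hdis y (comp_adj_mem hx hxy hyX) w hw)
  convert key Set.univ Set.finite_univ
  refine (Set.eq_univ_of_forall fun v => ?_).symm
  by_cases hv : v ∈ X
  · exact .inl hv
  · exact .inr (Set.mem_biUnion (Set.mem_univ v) (mem_comp_self hv))

theorem HasRootedDecomposition.exists_lenientTreeDecomposition {P : Set V → Prop} {X : Set V}
    (h : HasRootedDecomposition G P X Set.univ) :
    ∃ (ι : Type) (_ : Finite ι) (T : SimpleGraph ι) (χ : ι → Set V),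
      IsLenientTreeDecomposition G T χ ∧ ∀ t, P (χ t) := by
  obtain ⟨ι, hι, T, χ, r, hT, -, -, hE, hC, hP⟩ := h
  refine ⟨ι, hι, T, χ, ⟨hT, ?_, fun x y h => hE x trivial y trivial h, fun x => hC x trivial⟩, hP⟩
  refine Set.eq_univ_of_forall fun v => ?_
  obtain ⟨t, ht⟩ := (hC v trivial).nonempty
  exact Set.mem_iUnion.2 ⟨t, ht⟩

/-- `X` and `C` as adjacent bags. -/
theorem hasRootedDecomposition_pair {P : Set V → Prop} {X C : Set V} (hX : P X) (hC : P C)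
    (hd : Disjoint C X) : HasRootedDecomposition G P X (X ∪ C) := by
  refine ⟨Unit ⊕ Unit, inferInstance, glue ⊥ ⊥ () (), Sum.elim (fun _ => X) (fun _ => C), .inl (),
    glue_isTree .of_subsingleton .of_subsingleton _ _, rfl, ?_, ?_, ?_, ?_⟩
  · rintro (_ | _)
    · exact Set.subset_union_left
    · exact Set.subset_union_right
  · exact fun x hx y hy _ => ⟨.inl (), .inr (), .inr glue_root, hx, hy⟩
  · rintro x (hx | hx)
    · have := Set.disjoint_right.1 hd hx
      convert isConnectedSet_singleton (Sum.inl ())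
      ext (_ | _) <;> simp [hx, this]
    · have := Set.disjoint_left.1 hd hx
      convert isConnectedSet_singleton (Sum.inr ())
      ext (_ | _) <;> simp [hx, this]
  · rintro (_ | _)
    · exact hX
    · exact hC

/-- A connected set that meets `X` and contains a vertex `v` outside of a component `C` of `G - X`
has a connected part that avoids `C`, contains `v` and meets `X`. -/
theorem exists_connected_part {X S : Set V} {c v : V} (hS : IsConnectedSet G S)
    (hSX : (S ∩ X).Nonempty) (hvS : v ∈ S) (hv : v ∉ comp G X c) :
    ∃ Q ⊆ S, IsConnectedSet G Q ∧ v ∈ Q ∧ (Q ∩ X).Nonempty ∧ Disjoint Q (comp G X c) := by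
  by_cases hvX : v ∈ X
  · exact ⟨{v}, by simpa using hvS, isConnectedSet_singleton v, rfl, ⟨v, rfl, hvX⟩,
      by simpa using hv⟩
  -- Take the component of `v` in `S - X` and the first vertex of `S` beyond it, which lies in `X`.
  -- The component avoids `C`, since otherwise `v` would lie in `C`.
  have hR := comp_isConnectedSet (G := G) (X := Sᶜ ∪ X) (v := v) (by simp [hvS, hvX])
  have hvR := mem_comp_self (G := G) (X := Sᶜ ∪ X) (v := v) (by simp [hvS, hvX])
  have hdis := comp_disjoint (G := G) (Sᶜ ∪ X) v
  set R := comp G (Sᶜ ∪ X) v with hRdef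
  have hRS : R ⊆ S := fun z hz => by
    by_contra hzS
    exact Set.disjoint_left.1 hdis hz (.inl hzS)
  have hRX : Disjoint R X := hdis.mono_right Set.subset_union_right
  have hRC : Disjoint R (comp G X c) := Set.disjoint_left.2 fun z hz hzc => by
    have := subset_comp hR hz hRX hvR
    rw [comp_eq_of_mem hzc] at this
    exact hv this
  obtain ⟨z, hzS, hzX⟩ := hSX
  obtain ⟨x, -, hx, y, hyS, hy, hxy⟩ := hS.exists_crossing (U := R) ⟨v, hvS, hvR⟩
    ⟨z, hzS, fun h => Set.disjoint_left.1 hRX h hzX⟩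
  have hyX : y ∈ X := by
    by_contra hyX
    exact hy (comp_adj_mem hx hxy (by simp [hyS, hyX]))
  refine ⟨R ∪ {y}, Set.union_subset hRS (by simpa using hyS),
    hR.union_of_adj (isConnectedSet_singleton y) hx rfl hxy, .inl hvR, ⟨y, .inr rfl, hyX⟩,
    Set.disjoint_union_left.2 ⟨hRC, ?_⟩⟩
  simpa using fun h => Set.disjoint_left.1 (comp_disjoint X c) h hyX

/-- From a decomposition with a bag that covers `B` and avoids a component `C` of `G - X`, where
`X` is a minimum cover of `B`, one gets a decomposition of `G[X ∪ C]` with bag `X`. -/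
theorem hasRootedDecomposition_of_covers [Finite V] {k : ℕ} {B : Set (Set V)}
    (hB : IsStrictBramble G B) {X : Set V} (hX : Covers X B) (hXk : X.ncard ≤ k)
    (hXmin : ∀ Y, Covers Y B → X.ncard ≤ Y.ncard) {c : V} {ι : Type} [Finite ι]
    {T : SimpleGraph ι} {χ : ι → Set V} (h : IsLenientTreeDecomposition G T χ)
    (hχ : ∀ t, k < (χ t).ncard → ¬ Covers (χ t) (insert (comp G X c) B)) {s : ι}
    (hs : Covers (χ s) B) (hsC : Disjoint (χ s) (comp G X c)) :
    HasRootedDecomposition G (fun Y => k < Y.ncard → ¬ Covers Y B) X (X ∪ comp G X c) := by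
  set C := comp G X c with hC
  have hCX : Disjoint C X := comp_disjoint X c
  -- `⋂₀ F x` is the hull of `s` and the trace of `x`. Spreading each `x ∈ X` over its hull gives
  -- bag `X` at `s`.
  let F : V → Set (Set ι) := fun x => {A | IsConnectedSet T A ∧ s ∈ A ∧ {t | x ∈ χ t} ⊆ A}
  let Z : ι → Set V := fun t => {x ∈ X | t ∈ ⋂₀ F x}
  have hZ : ∀ {x A}, IsConnectedSet T A → s ∈ A → {t | x ∈ χ t} ⊆ A → ⋂₀ F x ⊆ A :=
    fun h1 h2 h3 => Set.sInter_subset_of_mem ⟨h1, h2, h3⟩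
  have hχZ : ∀ t x, x ∈ X → x ∈ χ t → x ∈ Z t := fun t x hx hxt => ⟨hx, fun A hA => hA.2.2 hxt⟩
  have hmeet : ∀ {Q : Set V} {x t}, IsConnectedSet G Q → (χ s ∩ Q).Nonempty → x ∈ Q →
      x ∈ Z t → (χ t ∩ Q).Nonempty := by
    intro Q x t hQ hsQ hxQ hxZ
    exact hZ (h.trace_isConnectedSet hQ) hsQ (fun t ht => ⟨x, ht, hxQ⟩) hxZ.2
  have hZcard : ∀ t, (Z t).ncard ≤ (χ t \ C).ncard := by
    intro t
    -- Exchange `Z t` for `χ t \ C` in the minimum cover `X`. A member of `B` has a connected part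
    -- off `C` from `χ s` to some `x ∈ X`. If `x ∈ Z t`, then `t` lies on the hull of `x`, which the
    -- trace of this part contains, so the part meets `χ t`.
    have hcov : Covers ((X \ Z t) ∪ (χ t \ C)) B := by
      intro S hS
      obtain ⟨v, hvS, hvs⟩ := hs S hS
      obtain ⟨Q, hQS, hQ, hvQ, ⟨x, hxQ, hxX⟩, hQC⟩ := exists_connected_part
        (hB.connected S hS) (hX S hS) hvS (Set.disjoint_left.1 hsC hvs)
      by_cases hxZ : x ∈ Z t
      · obtain ⟨z, hzt, hzQ⟩ := hmeet hQ ⟨v, hvs, hvQ⟩ hxQ hxZ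
        exact ⟨z, hQS hzQ, .inr ⟨hzt, Set.disjoint_left.1 hQC hzQ⟩⟩
      · exact ⟨x, hQS hxQ, .inl ⟨hxX, hxZ⟩⟩
    have h1 := (hXmin _ hcov).trans (Set.ncard_union_le _ _)
    have h2 := Set.ncard_sdiff_add_ncard_of_subset (s := Z t) (t := X) (fun x hx => hx.1)
    omega
  refine ⟨ι, inferInstance, T, fun t => (χ t ∩ C) ∪ Z t, s, h.isTree, ?_, ?_, ?_, ?_, ?_⟩
  · change (χ s ∩ C) ∪ Z s = X
    rw [hsC.inter_eq, Set.empty_union]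
    exact Set.Subset.antisymm (fun x hx => hx.1) fun x hx => ⟨hx, fun A hA => hA.2.1⟩
  · rintro t x (hx | hx)
    · exact .inr hx.2
    · exact .inl hx.1
  · have hsub : ∀ x ∈ X ∪ C, ∀ t, x ∈ χ t → x ∈ (χ t ∩ C) ∪ Z t := by
      rintro x (hx | hx) t hxt
      · exact .inr (hχZ t x hx hxt)
      · exact .inl ⟨hxt, hx⟩
    intro x hx y hy hxy
    obtain ⟨t, t', htt, hxt, hyt⟩ := h.edge x y hxy
    exact ⟨t, t', htt, hxt.imp (hsub x hx t) (hsub x hx t'), hyt.imp (hsub y hy t) (hsub y hy t')⟩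
  · intro x hx
    by_cases hxX : x ∈ X
    · convert isConnectedSet_sInter h.isTree (F := F x) (s := s) (fun A hA => hA.2.1)
        (fun A hA => hA.1) using 1
      ext t
      have : x ∉ C := Set.disjoint_right.1 hCX hxX
      simp [Z, this, hxX]
    · convert h.trace x using 1
      ext t
      simp [Z, hx.resolve_left hxX, hxX]
  · intro t htk hcov
    change k < ((χ t ∩ C) ∪ Z t).ncard at htk
    have hle : ((χ t ∩ C) ∪ Z t).ncard ≤ (χ t).ncard := by
      have h1 := Set.ncard_union_le (χ t ∩ C) (Z t)
      have h2 := Set.ncard_inter_add_ncard_sdiff_eq_ncard (χ t) C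
      have h3 := hZcard t
      omega
    -- A new bag that misses `C` lies in `X` and is not large. So a large one meets `C`, and if it
    -- covered `B`, the old bag would cover `B ∪ {C}`.
    have hmeetC : (χ t ∩ C).Nonempty := by
      by_contra hne
      rw [Set.not_nonempty_iff_eq_empty.1 hne, Set.empty_union] at htk
      have := Set.ncard_le_ncard (s := Z t) (t := X) (fun x hx => hx.1)
      omega
    refine hχ t (htk.trans_le hle) ?_
    rintro S (rfl | hS)
    · rwa [Set.inter_comm]
    · obtain ⟨w, hwS, hw | hw⟩ := hcov S hS
      · exact ⟨w, hwS, hw.1⟩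
      · rw [Set.inter_comm]
        refine hmeet (hB.connected S hS) ?_ hwS hw
        rw [Set.inter_comm]
        exact hs S hS

/-- The statement is strengthened from width to admissibility for `B` so that the induction can
enlarge `B`; there are finitely many collections of vertex sets. -/
theorem exists_admissible_decomposition [Finite V] {k : ℕ}
    (hG : ¬ ∃ B : Set (Set V), IsStrictBramble G B ∧ k < order B) (B : Set (Set V))
    (hB : IsStrictBramble G B) :
    ∃ (ι : Type) (_ : Finite ι) (T : SimpleGraph ι) (χ : ι → Set V),
      IsLenientTreeDecomposition G T χ ∧ ∀ t, k < (χ t).ncard → ¬ Covers (χ t) B := by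
  induction B using WellFoundedGT.induction with
  | ind B ih =>
  by_contra hcon
  obtain ⟨X, hX, hXk⟩ : ∃ X, Covers X B ∧ X.ncard ≤ k := by
    by_contra! h
    exact hG ⟨B, hB, (lt_order_iff hB).2 h⟩
  obtain ⟨X, hX, hXmin⟩ := Set.exists_min_image {X | Covers X B} Set.ncard (Set.toFinite _) ⟨X, hX⟩
  have hXk : X.ncard ≤ k := (hXmin _ ‹_›).trans hXk
  refine hcon (HasRootedDecomposition.exists_lenientTreeDecomposition
    (P := fun Y => k < Y.ncard → ¬ Covers Y B) (X := X)
    (.of_comps (fun h => absurd h (not_lt.2 hXk)) fun c hc => ?_))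
  -- If a member of `B` misses the component, the component does not cover `B` and may be a single
  -- bag, whatever its size.
  by_cases hmiss : ∃ S ∈ B, Disjoint S (comp G X c)
  · obtain ⟨S, hS, hSC⟩ := hmiss
    refine hasRootedDecomposition_pair (fun h => absurd h (not_lt.2 hXk)) (fun _ h => ?_)
      (comp_disjoint X c)
    exact Set.not_nonempty_iff_eq_empty.2 hSC.inter_eq (h S hS)
  have hmeet : ∀ S ∈ B, (S ∩ comp G X c).Nonempty := fun S hS =>
    Set.not_disjoint_iff_nonempty_inter.1 fun h => hmiss ⟨S, hS, h⟩
  have hcc := comp_isConnectedSet (G := G) hc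
  have hB' : IsStrictBramble G (insert (comp G X c) B) := by
    refine ⟨?_, ?_⟩
    · rintro S (rfl | hS)
      · exact hcc
      · exact hB.connected S hS
    · rintro S (rfl | hS) S' (rfl | hS')
      · simpa using hcc.nonempty
      · simpa [Set.inter_comm] using hmeet S' hS'
      · exact hmeet S hS
      · exact hB.intersecting S hS S' hS'
  have hCB : comp G X c ∉ B := fun h => by
    obtain ⟨x, hx, hxX⟩ := hX _ h
    exact Set.disjoint_left.1 (comp_disjoint X c) hx hxX
  obtain ⟨ι, _, T, χ, hT, hχ⟩ := ih _ (Set.ssubset_insert hCB) hB'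
  -- The decomposition for the larger bramble is not admissible for `B`, so a large bag covers `B`;
  -- it must then miss the new member.
  obtain ⟨s, hsk, hs⟩ : ∃ s, k < (χ s).ncard ∧ Covers (χ s) B := by
    by_contra! h
    exact hcon ⟨ι, ‹_›, T, χ, hT, h⟩
  refine hasRootedDecomposition_of_covers hB hX hXk hXmin hT hχ hs ?_
  rw [Set.disjoint_iff_inter_eq_empty, ← Set.not_nonempty_iff_eq_empty]
  intro hne
  refine hχ s hsk ?_
  rintro S (rfl | hS)
  · rwa [Set.inter_comm]
  · exact hs S hS

/-- A graph without strict brambles of order more than `k` has a lenient tree decomposition of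
width at most `k`. -/
theorem exists_lenientTreeDecomposition_of_not_bramble [Finite V] {k : ℕ}
    (hG : ¬ ∃ B : Set (Set V), IsStrictBramble G B ∧ k < order B) :
    ∃ (ι : Type) (_ : Finite ι) (T : SimpleGraph ι) (χ : ι → Set V),
      IsLenientTreeDecomposition G T χ ∧ ∀ t, (χ t).ncard ≤ k := by
  obtain ⟨ι, hι, T, χ, hT, hχ⟩ := exists_admissible_decomposition hG ∅ ⟨by simp, by simp⟩
  exact ⟨ι, hι, T, χ, hT, fun t => not_lt.1 fun h => hχ t h fun _ h => h.elim⟩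

end Duality

/-! ### Minimal separators and maximal cliques of chordal graphs. -/

section Chordal

variable {V : Type*} {G : SimpleGraph V}

/-- A chordal graph has no induced cycle of length at least four. -/
theorem IsChordal.false_of_hole (hG : IsChordal G) {n : ℕ} (hn : 4 ≤ n) (f : ℕ → V)
    (hinj : ∀ i j, i < j → j < n → f i ≠ f j)
    (hadj : ∀ i j, i < j → j < n → (G.Adj (f i) (f j) ↔ j = i + 1 ∨ (i = 0 ∧ j + 1 = n))) :
    False := by
  have hcyc : ∀ i j : Fin n, i < j → ((SimpleGraph.cycleGraph n).Adj i j ↔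
      (j : ℕ) = i + 1 ∨ ((i : ℕ) = 0 ∧ (j : ℕ) + 1 = n)) := by
    intro i j hij
    have hij' : (i : ℕ) < j := hij
    have hj := j.2
    rw [SimpleGraph.cycleGraph_adj', Fin.sub_val_of_le hij.le, Fin.coe_sub_iff_lt.2 hij]
    omega
  have hall : ∀ i j : Fin n, G.Adj (f i) (f j) ↔ (SimpleGraph.cycleGraph n).Adj i j := by
    intro i j
    rcases lt_trichotomy i j with h | rfl | h
    · rw [hcyc i j h, hadj i j h j.2]
    · simp
    · rw [G.adj_comm, (SimpleGraph.cycleGraph n).adj_comm, hcyc j i h, hadj j i h i.2]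
  have hfi : Function.Injective fun i : Fin n => f i := by
    intro i j hij
    rcases lt_trichotomy i j with h | h | h
    · exact absurd hij (hinj i j h j.2)
    · exact h
    · exact absurd hij.symm (hinj j i h i.2)
  have := hG n (by omega) ⟨⟨⟨fun i => f i, hfi⟩, hall _ _⟩⟩
  omega

/-- Two nonadjacent vertices with neighbours in a connected set `E` are joined by an induced path
through `E`. -/
theorem exists_induced_path {E : Set V} (hE : IsConnectedSet G E) {s s' : V}
    (hne : s ≠ s') (hns : ¬ G.Adj s s') (h : ∃ x ∈ E, G.Adj s x)
    (h' : ∃ x ∈ E, G.Adj s' x) :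
    ∃ (m : ℕ) (p : ℕ → V), 2 ≤ m ∧ p 0 = s ∧ p m = s' ∧ (∀ i, 0 < i → i < m → p i ∈ E) ∧
      (∀ i j, i < j → j ≤ m → p i ≠ p j) ∧
      ∀ i j, i < j → j ≤ m → (G.Adj (p i) (p j) ↔ j = i + 1) := by
  obtain ⟨x, hx, hsx⟩ := h
  obtain ⟨y, hy, hsy⟩ := h'
  have hconn : IsConnectedSet G (insert s (insert s' E)) := by
    have h1 := (isConnectedSet_singleton (G := G) s').union_of_adj hE rfl hy hsy
    exact (isConnectedSet_singleton (G := G) s).union_of_adj h1 rfl (.inr hx) hsx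
  set A := insert s (insert s' E) with hA
  let H := G.induce A
  -- A shortest walk in the induced subgraph has neither repetitions nor chords.
  obtain ⟨w, hw⟩ :=
    (hconn.preconnected ⟨s, by simp [hA]⟩ ⟨s', by simp [hA]⟩).exists_walk_length_eq_dist
  have hlen : ∀ i j, i < j → j ≤ w.length → (w.getVert i = w.getVert j ∨
      H.Adj (w.getVert i) (w.getVert j)) → j = i + 1 ∧ w.getVert i ≠ w.getVert j := by
    intro i j hij hj hor
    have h1 := SimpleGraph.dist_le (w.take i)
    have h2 := SimpleGraph.dist_le (w.drop j)
    rw [SimpleGraph.Walk.take_length] at h1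
    rw [SimpleGraph.Walk.drop_length] at h2
    have h3 := hconn.dist_triangle (u := ⟨s, by simp [hA]⟩) (v := w.getVert i)
      (w := ⟨s', by simp [hA]⟩)
    have h4 := hconn.dist_triangle (u := w.getVert i) (v := w.getVert j)
      (w := ⟨s', by simp [hA]⟩)
    rcases hor with heq | hadj
    · rw [heq] at h3 h1
      omega
    · have h5 := SimpleGraph.dist_eq_one_iff_adj.2 hadj
      have h6 : (G.induce A).dist (w.getVert i) (w.getVert j) = 1 := h5
      exact ⟨by omega, hadj.ne⟩
  have hmem : ∀ i, 0 < i → i < w.length → (w.getVert i : V) ∈ E := by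
    intro i hi hil
    rcases (w.getVert i).2 with h | h | h
    · have : w.getVert 0 = w.getVert i := by
        rw [SimpleGraph.Walk.getVert_zero]
        exact Subtype.ext h.symm
      exact absurd this (hlen 0 i hi hil.le (.inl this)).2
    · have : w.getVert i = w.getVert w.length := by
        rw [SimpleGraph.Walk.getVert_length]
        exact Subtype.ext h
      exact absurd this (hlen i _ hil le_rfl (.inl this)).2
    · exact h
  refine ⟨w.length, fun i => w.getVert i, ?_, by simp, by simp, hmem, ?_, ?_⟩
  · by_contra hlt
    have : w.length = 0 ∨ w.length = 1 := by omega
    rcases this with h0 | h1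
    · exact hne (congrArg Subtype.val (SimpleGraph.Walk.eq_of_length_eq_zero h0))
    · have h := SimpleGraph.Walk.adj_of_length_eq_one h1
      exact hns h
  · intro i j hij hj heq
    exact (hlen i j hij hj (.inl (Subtype.ext heq))).2 (Subtype.ext heq)
  · intro i j hij hj
    constructor
    · exact fun h => (hlen i j hij hj (.inr h)).1
    · rintro rfl
      exact w.adj_getVert_succ (by omega)

/-- In a chordal graph, two vertices with neighbours in two disjoint connected sets without edges
between them are adjacent. -/
theorem IsChordal.adj_of_two_sides (hG : IsChordal G) {E F : Set V} (hE : IsConnectedSet G E)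
    (hF : IsConnectedSet G F) (hEF : Disjoint E F) (hanti : ∀ x ∈ E, ∀ y ∈ F, ¬ G.Adj x y)
    {s s' : V} (hsF : s ∉ F) (hne : s ≠ s')
    (h1 : ∃ x ∈ E, G.Adj s x) (h2 : ∃ x ∈ F, G.Adj s x) (h3 : ∃ x ∈ E, G.Adj s' x)
    (h4 : ∃ x ∈ F, G.Adj s' x) : G.Adj s s' := by
  by_contra hns
  obtain ⟨m, p, hm, hp0, hpm, hpE, hpne, hpadj⟩ := exists_induced_path hE hne hns h1 h3
  obtain ⟨r, q, hr, hq0, hqr, hqF, hqne, hqadj⟩ :=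
    exists_induced_path hF hne.symm (fun h => hns h.symm) h4 h2
  -- Run along `p` from `s` to `s'` and back along `q`: an induced cycle of length `m + r ≥ 4`.
  let f : ℕ → V := fun i => if i ≤ m then p i else q (i - m)
  have hfp : ∀ {i}, i ≤ m → f i = p i := fun h => if_pos h
  have hfq : ∀ {i}, m ≤ i → f i = q (i - m) := by
    intro i hi
    rcases hi.eq_or_lt with rfl | h
    · rw [hfp le_rfl, hpm, Nat.sub_self, hq0]
    · exact if_neg (by omega)
  refine hG.false_of_hole (n := m + r) (by omega) f ?_ ?_
  · intro i j hij hj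
    rcases le_or_gt j m with hjm | hjm
    · rw [hfp (hij.le.trans hjm), hfp hjm]
      exact hpne i j hij hjm
    · have hjF := hqF (j - m) (by omega) (by omega)
      rcases le_or_gt m i with him | him
      · rw [hfq him, hfq hjm.le]
        exact hqne _ _ (by omega) (by omega)
      · rw [hfp him.le, hfq hjm.le]
        rcases Nat.eq_zero_or_pos i with rfl | hi
        · rw [hp0]
          exact fun h => hsF (h ▸ hjF)
        · exact fun h => Set.disjoint_left.1 hEF (hpE i hi him) (h ▸ hjF)
  · intro i j hij hj
    rcases le_or_gt j m with hjm | hjm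
    · rw [hfp (hij.le.trans hjm), hfp hjm, hpadj i j hij hjm]
      omega
    · have hjF := hqF (j - m) (by omega) (by omega)
      rcases le_or_gt m i with him | him
      · rw [hfq him, hfq hjm.le, hqadj _ _ (by omega) (by omega)]
        omega
      · rw [hfp him.le, hfq hjm.le]
        rcases Nat.eq_zero_or_pos i with rfl | hi
        · rw [hp0, ← hqr, G.adj_comm, hqadj _ _ (by omega) le_rfl]
          omega
        · have := hanti _ (hpE i hi him) _ hjF
          simp only [this, false_iff]
          omega

/-- In a chordal graph, if every vertex of a clique has a neighbour in a connected set, then some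
vertex of the connected set is adjacent to the whole clique. -/
theorem IsChordal.exists_complete [Finite V] (hG : IsChordal G) {E : Set V}
    (hE : IsConnectedSet G E) {Q : Set V} (hQ : G.IsClique Q) (hd : Disjoint Q E)
    (hn : ∀ q ∈ Q, ∃ x ∈ E, G.Adj q x) : ∃ x ∈ E, ∀ q ∈ Q, G.Adj q x := by
  have hfin := Set.toFinite Q
  induction Q, hfin using Set.Finite.induction_on with
  | empty => exact hE.nonempty.imp fun x hx => ⟨hx, by simp⟩
  | @insert q Q hqQ _ ih =>
    obtain ⟨e, he, heQ⟩ := ih (hQ.subset (Set.subset_insert _ _))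
      (hd.mono_left (Set.subset_insert _ _)) fun x hx => hn x (.inr hx)
    by_cases hqe : G.Adj q e
    · exact ⟨e, he, by rintro x (rfl | hx); exacts [hqe, heQ x hx]⟩
    obtain ⟨z, hzE, hqz⟩ := hn q (.inl rfl)
    -- Walk inside `E` from `e` to the first neighbour `y` of `q`. The part `R` already explored has
    -- no neighbour of `q`, so `R` and `{q}` are two sides that make `y` adjacent to each `q' ∈ Q`.
    have hdE : ∀ {x}, x ∈ insert q Q → x ∉ E := fun h => Set.disjoint_left.1 hd h
    have heX : e ∉ Eᶜ ∪ {x | G.Adj q x} := by simp [he, hqe]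
    have hconn := comp_isConnectedSet (G := G) heX
    have hself := mem_comp_self (G := G) heX
    have hdis := comp_disjoint (G := G) (Eᶜ ∪ {x | G.Adj q x}) e
    set R := comp G (Eᶜ ∪ {x | G.Adj q x}) e with hR
    have hRE : ∀ x ∈ R, x ∈ E := fun x hx => by
      by_contra h
      exact Set.disjoint_left.1 hdis hx (.inl h)
    have hRq : ∀ x ∈ R, ¬ G.Adj q x := fun x hx h => Set.disjoint_left.1 hdis hx (.inr h)
    obtain ⟨x, -, hx, y, hyE, hy, hxy⟩ := hE.exists_crossing (U := R) ⟨e, he, hself⟩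
      ⟨z, hzE, fun h => hRq z h hqz⟩
    have hqy : G.Adj q y := by
      by_contra h
      exact hy (comp_adj_mem hx hxy (by simp [hyE, h]))
    refine ⟨y, hyE, ?_⟩
    rintro q' (rfl | hq')
    · exact hqy
    have hqq' : G.Adj q q' := hQ (.inl rfl) (.inr hq') (fun h => hqQ (h ▸ hq'))
    refine hG.adj_of_two_sides hconn (isConnectedSet_singleton q) ?_ ?_
      hqq'.ne.symm (fun h => hdE (.inr hq') (h ▸ hyE)) ⟨e, hself, heQ q' hq'⟩ ⟨q, rfl, hqq'.symm⟩
      ⟨x, hx, hxy.symm⟩ ⟨q, rfl, hqy.symm⟩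
    · simpa using fun h => hdE (.inl rfl) (hRE _ h)
    · rintro a ha b rfl h
      exact hRq a ha h.symm

/-- The vertices outside of `E` with a neighbour in `E`. -/
def nbhd (G : SimpleGraph V) (E : Set V) : Set V :=
  {y | y ∉ E ∧ ∃ x ∈ E, G.Adj x y}

theorem nbhd_comp_subset (X : Set V) (v : V) : nbhd G (comp G X v) ⊆ X := by
  rintro y ⟨hy, x, hx, hxy⟩
  by_contra hyX
  exact hy (comp_adj_mem hx hxy hyX)

theorem subset_of_disjoint_nbhd {C X : Set V} (hC : C.Nonempty) (hCX : C ⊆ X)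
    (hX : IsConnectedSet G X) (h : Disjoint (nbhd G C) X) : X ⊆ C := by
  obtain ⟨x, hx⟩ := hC
  refine hX.subset_of_closed ⟨x, hCX hx, hx⟩ fun a _ haC b hb hab => ?_
  by_contra hbC
  exact Set.disjoint_left.1 h ⟨hbC, a, haC, hab⟩ hb

/-- The neighbourhood of a connected set `E` is a minimal separator if all its vertices have
neighbours in a connected set that is disjoint from `E` and its neighbourhood. -/
theorem isMinimalSeparator_nbhd {E F : Set V} (hE : IsConnectedSet G E) (hF : IsConnectedSet G F)
    (hFE : Disjoint F E) (hFN : Disjoint F (nbhd G E)) (h : ∀ z ∈ nbhd G E, ∃ y ∈ F, G.Adj z y) :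
    IsMinimalSeparator G (nbhd G E) := by
  obtain ⟨x, hx⟩ := hE.nonempty
  obtain ⟨y, hy⟩ := hF.nonempty
  refine ⟨x, y, isSeparator_iff.2 ⟨fun h => h.1 hx, Set.disjoint_left.1 hFN hy, ?_⟩, ?_⟩
  · rintro ⟨A, hA, hxA, hyA, hAN⟩
    have : A ⊆ E := hA.subset_of_closed ⟨x, hxA, hx⟩ fun a _ haE b hb hab => by
      by_contra hbE
      exact Set.disjoint_left.1 hAN hb ⟨hbE, a, haE, hab⟩
    exact Set.disjoint_left.1 hFE hy (this hyA)
  · intro S hS hSN z hz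
    by_contra hzS
    obtain ⟨hxS, hyS, hxy⟩ := isSeparator_iff.1 hS
    obtain ⟨w, hw, hzw⟩ := h z hz
    obtain ⟨hzE, e, he, hez⟩ := hz
    refine hxy ⟨(E ∪ {z}) ∪ F,
      (hE.union_of_adj (isConnectedSet_singleton z) he rfl hez).union_of_adj
      hF (.inr rfl) hw hzw, .inl (.inl hx), .inr hy, ?_⟩
    rw [Set.disjoint_union_left, Set.disjoint_union_left]
    refine ⟨⟨?_, by simpa using hzS⟩, hFN.mono_right hSN⟩
    exact Set.disjoint_left.2 fun a ha haS => (hSN haS).1 ha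

/-- Both sides of a minimal separator are full. -/
theorem exists_adj_of_minimal {x y : V} {S : Set V} (h : Minimal (IsSeparator G x y) S) {s : V}
    (hs : s ∈ S) : (∃ a ∈ comp G S x, G.Adj s a) ∧ ∃ a ∈ comp G S y, G.Adj s a := by
  obtain ⟨hxS, hyS, hxy⟩ := isSeparator_iff.1 h.1
  have hns : ¬ IsSeparator G x y (S \ {s}) := fun h' =>
    (h.2 h' Set.sdiff_subset hs).2 rfl
  rw [isSeparator_iff] at hns
  have : y ∈ comp G (S \ {s}) x := by
    by_contra hy
    exact hns ⟨fun h => hxS h.1, fun h => hyS h.1, hy⟩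
  obtain ⟨A, hA, hxA, hyA, hAS⟩ := this
  have key : ∀ {x y}, x ∈ A → y ∈ A → x ∉ S → y ∉ comp G S x → ∃ a ∈ comp G S x, G.Adj s a := by
    intro x y hx hy hxS hyx
    obtain ⟨a, -, ha, b, hbA, hb, hab⟩ := hA.exists_crossing (U := comp G S x)
      ⟨x, hx, mem_comp_self hxS⟩ ⟨y, hy, hyx⟩
    have hbS : b ∈ S := by
      by_contra hbS
      exact hb (comp_adj_mem ha hab hbS)
    have : b = s := by
      by_contra hbs
      exact Set.disjoint_left.1 hAS hbA ⟨hbS, hbs⟩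
    exact ⟨a, ha, this ▸ hab.symm⟩
  refine ⟨key hxA hyA hxS hxy, key hyA hxA hyS fun hx => hxy ?_⟩
  rw [comp_eq_of_mem hx]
  exact mem_comp_self hyS

/-- Each vertex of `S` has neighbours in both components that `S` separates, so
`IsChordal.adj_of_two_sides` applies to every pair. -/
theorem IsChordal.isClique_of_isMinimalSeparator (hG : IsChordal G) {S : Set V}
    (hS : IsMinimalSeparator G S) : G.IsClique S := by
  obtain ⟨x, y, h⟩ := hS
  obtain ⟨hxS, hyS, hxy⟩ := isSeparator_iff.1 h.1
  have hdx := comp_disjoint (G := G) S x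
  have hdy := comp_disjoint (G := G) S y
  have hne : ∀ a ∈ comp G S x, a ∉ comp G S y := fun a ha ha' => hxy <| by
    rw [← comp_eq_of_mem ha, comp_eq_of_mem ha']
    exact mem_comp_self hyS
  intro s hs s' hs' hss
  refine hG.adj_of_two_sides (comp_isConnectedSet hxS) (comp_isConnectedSet hyS)
    (Set.disjoint_left.2 hne) (fun a ha b hb hab => ?_) (Set.disjoint_right.1 hdy hs) hss
    (exists_adj_of_minimal h hs).1 (exists_adj_of_minimal h hs).2
    (exists_adj_of_minimal h hs').1 (exists_adj_of_minimal h hs').2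
  exact hne b (comp_adj_mem ha hab (Set.disjoint_left.1 hdy hb)) hb

/-- The neighbourhood of a component of `G - S` is a minimal separator if `S` is one. -/
theorem isMinimalSeparator_nbhd_comp {S : Set V} (hS : IsMinimalSeparator G S) {v : V}
    (hv : v ∉ S) : IsMinimalSeparator G (nbhd G (comp G S v)) := by
  obtain ⟨x, y, h⟩ := hS
  obtain ⟨hxS, hyS, hxy⟩ := isSeparator_iff.1 h.1
  -- Of the two full components at `x` and `y`, at least one differs from the component of `v` and
  -- serves as the other side.
  have key : ∀ {z}, z ∉ S → z ∉ comp G S v → (∀ s ∈ S, ∃ a ∈ comp G S z, G.Adj s a) →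
      IsMinimalSeparator G (nbhd G (comp G S v)) := by
    intro z hzS hz hfull
    refine isMinimalSeparator_nbhd (comp_isConnectedSet hv) (comp_isConnectedSet hzS) ?_
      ((comp_disjoint S z).mono_right (nbhd_comp_subset S v))
      fun s hs => hfull s (nbhd_comp_subset S v hs)
    refine Set.disjoint_left.2 fun a ha ha' => hz ?_
    rw [← comp_eq_of_mem ha', comp_eq_of_mem ha]
    exact mem_comp_self hzS
  by_cases hyv : y ∈ comp G S v
  · refine key hxS (fun hxv => hxy ?_) fun s hs => (exists_adj_of_minimal h hs).1
    rwa [comp_eq_of_mem hxv]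
  · exact key hyS hyv fun s hs => (exists_adj_of_minimal h hs).2

/-- In a chordal graph, the neighbourhood of a component outside of a maximal clique is a minimal
separator in the clique. -/
theorem IsChordal.isMinimalSeparator_of_isMaxClique [Finite V] (hG : IsChordal G) {K : Set V}
    (hK : IsMaxClique G K) {v : V} (hv : v ∉ K) :
    IsMinimalSeparator G (nbhd G (comp G K v)) := by
  have hconn := comp_isConnectedSet (G := G) hv
  have hsub := nbhd_comp_subset (G := G) K v
  have hdis := comp_disjoint (G := G) K v
  -- If all of `K` had neighbours in the component, a vertex of the component complete to `K` would
  -- extend the clique. The spare vertex `z` is the other side.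
  obtain ⟨z, hzK, hz⟩ : ∃ z ∈ K, z ∉ nbhd G (comp G K v) := by
    by_contra! hall
    obtain ⟨x, hx, hxK⟩ := hG.exists_complete hconn hK.1 hdis.symm
      fun q hq => let ⟨_, x, hx, hxq⟩ := hall q hq; ⟨x, hx, hxq.symm⟩
    have := hK.2 (hK.1.insert fun q hq _ => (hxK q hq).symm) (Set.subset_insert x K)
    exact Set.disjoint_left.1 hdis hx (this (.inl rfl))
  refine isMinimalSeparator_nbhd hconn (isConnectedSet_singleton z) ?_ (by simpa using hz)
    fun w hw => ⟨z, rfl, ?_⟩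
  · simpa using Set.disjoint_right.1 hdis hzK
  · exact hK.1 (hsub hw) hzK fun h => hz (h ▸ hw)

end Chordal

/-! ### Domino-trees have no strict bramble of large order. -/

section Domino

variable {V : Type*} {G : SimpleGraph V}

theorem exists_isMinimalSeparator [Finite V] {x y : V} (hne : x ≠ y) (h : ¬ G.Adj x y) :
    ∃ S, IsMinimalSeparator G S := by
  have hsep : IsSeparator G x y {x, y}ᶜ := by
    refine isSeparator_iff.2 ⟨by simp, by simp, ?_⟩
    rintro ⟨A, hA, hx, hy, hd⟩
    obtain ⟨a, haA, rfl, b, hbA, hb, hab⟩ := hA.exists_crossing (U := {x}) ⟨x, hx, rfl⟩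
      ⟨y, hy, hne.symm⟩
    have : b ∈ ({a, y} : Set V) := by
      by_contra hb'
      exact Set.disjoint_left.1 hd hbA hb'
    rcases this with rfl | rfl
    · exact hb rfl
    · exact h hab
  obtain ⟨S, -, hS⟩ := exists_minimal_le_of_wellFoundedLT (IsSeparator G x y) _ hsep
  exact ⟨S, x, y, hS⟩

theorem IsStrictBramble.false_of_split {B : Set (Set V)} (hB : IsStrictBramble G B) {S S' X : Set V}
    (hS : S ∈ B) (hS' : S' ∈ B) (h : S ⊆ X) (h' : Disjoint S' X) : False := by
  obtain ⟨x, hx, hx'⟩ := hB.intersecting S hS S' hS'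
  exact Set.disjoint_left.1 h' hx' (h hx)

/-- A graph with the properties (i) to (v) of a `k`-domino-tree has no strict bramble of order
more than `k`. -/
theorem DominoProperties.not_lt_order [Finite V] {k : ℕ} (hG : DominoProperties G k)
    {B : Set (Set V)} (hB : IsStrictBramble G B) : ¬ k < order B := by
  intro hlt
  have hmiss : ∀ X : Set V, X.ncard ≤ k → ∃ S ∈ B, Disjoint S X := by
    intro X hX
    by_contra! h
    exact absurd ((lt_order_iff hB).1 hlt X fun S hS =>
      Set.not_disjoint_iff_nonempty_inter.1 (h S hS))
      (not_lt.2 hX)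
  by_cases hsep : ∃ S, IsMinimalSeparator G S
  swap
  -- Without minimal separators the graph is complete on at most `2k` vertices. Split these into two
  -- sets of size at most `k`; members that miss one set each are disjoint.
  · have hcl : G.IsClique Set.univ := fun x _ y _ hne => by
      by_contra h
      exact hsep (exists_isMinimalSeparator hne h)
    have hcard := hG.clique_card Set.univ ⟨hcl, fun _ _ _ => Set.subset_univ _⟩
    obtain ⟨X, -, hX⟩ := Set.exists_subset_card_eq (s := (Set.univ : Set V)) (n := k) (by omega)
    have := Set.ncard_add_ncard_compl X
    rw [Set.ncard_univ] at hcard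
    obtain ⟨S, hS, hSX⟩ := hmiss X hX.le
    obtain ⟨S', hS', hSX'⟩ := hmiss Xᶜ (by omega)
    exact hB.false_of_split hS' hS (Set.disjoint_compl_right_iff_subset.1 hSX') hSX
  have hbeta : ∀ S, IsMinimalSeparator G S → ∃ c, c ∉ S ∧ ∃ A ∈ B, A ⊆ comp G S c := by
    intro S hS
    obtain ⟨A, hA, hAS⟩ := hmiss S (hG.separator_card S hS).le
    obtain ⟨c, hc⟩ := (hB.connected A hA).nonempty
    exact ⟨c, Set.disjoint_left.1 hAS hc, A, hA, subset_comp (hB.connected A hA) hc hAS⟩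
  -- All minimal separators have size `k`, so none contains another properly, and every component of
  -- `G - S` sees all of `S`.
  have hN : ∀ S, IsMinimalSeparator G S → ∀ c, c ∉ S → nbhd G (comp G S c) = S := by
    intro S hS c hc
    refine Set.eq_of_subset_of_ncard_le (nbhd_comp_subset S c) ?_
    rw [hG.separator_card S hS, hG.separator_card _ (isMinimalSeparator_nbhd_comp hS hc)]
  obtain ⟨S₀, hS₀⟩ := hsep
  obtain ⟨c₀, hc₀⟩ := hbeta S₀ hS₀
  -- A smallest component that contains a member of the bramble, over all minimal separators.
  obtain ⟨⟨S, c⟩, ⟨hS, hc, A, hA, hAC⟩, hmin⟩ := Set.exists_min_image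
    {p : Set V × V | IsMinimalSeparator G p.1 ∧ p.2 ∉ p.1 ∧ ∃ A ∈ B, A ⊆ comp G p.1 p.2}
    (fun p => (comp G p.1 p.2).ncard) (Set.toFinite _) ⟨(S₀, c₀), hS₀, hc₀⟩
  dsimp only at hS hc hAC
  have hNC := hN S hS c hc
  have hCS := comp_disjoint (G := G) S c
  have hCc := comp_isConnectedSet (G := G) hc
  have hadjC : ∀ x ∈ comp G S c, ∀ y, G.Adj x y → y ∈ S ∪ comp G S c := fun x hx y hxy => by
    by_contra hy
    exact hy (.inr (comp_adj_mem hx hxy fun h => hy (.inl h)))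
  have hScl := hG.chordal.isClique_of_isMinimalSeparator hS
  obtain ⟨w, hwC, hw⟩ := hG.chordal.exists_complete hCc hScl hCS.symm fun q hq => by
    rw [← hNC] at hq
    obtain ⟨-, x, hx, hxq⟩ := hq
    exact ⟨x, hx, hxq.symm⟩
  obtain ⟨K, hKw, hK⟩ := exists_maximal_ge_of_wellFoundedGT G.IsClique (insert w S)
    (hScl.insert fun q hq _ => (hw q hq).symm)
  have hwK : w ∈ K := hKw (.inl rfl)
  have hSK : S ⊆ K := (Set.subset_insert w S).trans hKw
  have hKC : K ⊆ S ∪ comp G S c := fun y hy => by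
    by_cases hwy : w = y
    · exact .inr (hwy ▸ hwC)
    · exact hadjC w hwC y (hK.1 hwK hy hwy)
  have hsepK : S ∈ separatorsIn G K := ⟨hS, hSK⟩
  have hNK : ∀ v, v ∉ K → nbhd G (comp G K v) ∈ separatorsIn G K := fun v hv =>
    ⟨hG.chordal.isMinimalSeparator_of_isMaxClique hK hv, nbhd_comp_subset K v⟩
  have hsubK : ∀ {X v}, X ⊆ K → v ∉ K → v ∈ comp G X v ∧ comp G K v ⊆ comp G X v := fun hX hv =>
    ⟨mem_comp_self fun h => hv (hX h), subset_comp (comp_isConnectedSet hv) (mem_comp_self hv)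
      ((comp_disjoint K _).mono_right hX)⟩
  -- A component of `G - K` whose neighbourhood is all of `X` is a whole component of `G - X`, hence
  -- cannot lie in one that meets `K`.
  have hinC : ∀ X u v, X ⊆ K → u ∉ X → v ∉ K → v ∈ comp G X u → (comp G X u ∩ K).Nonempty →
      nbhd G (comp G K v) ≠ X := by
    rintro X u v hXK hu hv hvX ⟨z, hz, hzK⟩ hne
    have hsub : comp G K v ⊆ comp G X u := by
      rw [← comp_eq_of_mem hvX]
      exact (hsubK hXK hv).2
    have := subset_of_disjoint_nbhd ⟨v, mem_comp_self hv⟩ hsub (comp_isConnectedSet hu)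
      (hne.symm ▸ (comp_disjoint X u).symm)
    exact Set.disjoint_left.1 (comp_disjoint K v) (this hz) hzK
  by_cases hone : separatorsIn G K = {S}
  · have hCK : comp G S c ⊆ K \ S := by
      intro v hv
      refine ⟨?_, Set.disjoint_left.1 hCS hv⟩
      by_contra hvK
      have := hNK v hvK
      rw [hone] at this
      exact hinC S c v hSK hc hvK hv ⟨w, hwC, hwK⟩ this
    have h1 := Set.ncard_sdiff_add_ncard_of_subset hSK
    have h2 := hG.separator_card S hS
    have h3 := hG.clique_card K hK
    have h4 := Set.ncard_le_ncard hCK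
    obtain ⟨A', hA', hd⟩ := hmiss (comp G S c) (by omega)
    exact hB.false_of_split hA hA' hAC hd
  obtain ⟨S', hS'K, hne⟩ : ∃ S' ∈ separatorsIn G K, S' ≠ S := by
    by_contra! h
    exact hone (Set.Subset.antisymm h (by simpa using hsepK))
  have hpair : separatorsIn G K = {S, S'} := by
    refine (Set.eq_of_subset_of_ncard_le ?_ ?_).symm
    · exact Set.insert_subset hsepK (by simpa using hS'K)
    · rw [Set.ncard_pair hne.symm]
      exact hG.clique_separators K hK
  have hKu := hG.clique_eq_union K hK S S' hne.symm hpair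
  obtain ⟨c', hc', A', hA', hAC'⟩ := hbeta S' hS'K.1
  obtain ⟨v, hvA, hvA'⟩ := hB.intersecting A hA A' hA'
  have hv := hAC hvA
  have hv' := hAC' hvA'
  have hvK : v ∉ K := by
    rw [hKu]
    rintro (h | h)
    · exact Set.disjoint_left.1 hCS hv h
    · exact Set.disjoint_left.1 (comp_disjoint S' c') hv' h
  -- A component of `G - S'` that avoids `K` would lie properly inside the chosen one, against
  -- minimality.
  have hmeet : (comp G S' c' ∩ K).Nonempty := by
    by_contra hno
    have hdis : Disjoint (comp G S' c') K :=
      Set.disjoint_iff_inter_eq_empty.2 (Set.not_nonempty_iff_eq_empty.1 hno)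
    have hsub : comp G S' c' ⊆ comp G S c := by
      rw [← comp_eq_of_mem hv]
      exact subset_comp (comp_isConnectedSet hc') hv' (hdis.mono_right hSK)
    have hss : comp G S' c' ⊂ comp G S c :=
      ⟨hsub, fun h => Set.disjoint_left.1 hdis (h hwC) hwK⟩
    exact absurd (hmin (S', c') ⟨hS'K.1, hc', A', hA', hAC'⟩) (not_le.2 (Set.ncard_lt_ncard hss))
  have := hNK v hvK
  rw [hpair] at this
  rcases this with h | h
  · exact hinC S c v hSK hc hvK hv ⟨w, hwC, hwK⟩ h
  · exact hinC S' c' v hS'K.2 hc' hvK hv' hmeet h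

end Domino

/-! ### Optimal decompositions: contractions, separators and cliques. -/

section Optimal

variable {V : Type*}

/-- `G` has a lenient tree decomposition of width at most `k`. -/
def HasLenientWidth (G : SimpleGraph V) (k : ℕ) : Prop :=
  ∃ (ι : Type) (_ : Finite ι) (T : SimpleGraph ι) (χ : ι → Set V),
    IsLenientTreeDecomposition G T χ ∧ ∀ t, (χ t).ncard ≤ k

/-- The largest graph with lenient tree decomposition `(T, χ)`. -/
def bagGraph {ι : Type*} (T : SimpleGraph ι) (χ : ι → Set V) : SimpleGraph V :=
  SimpleGraph.fromRel fun x y => ∃ t t', (t = t' ∨ T.Adj t t') ∧ x ∈ χ t ∪ χ t' ∧ y ∈ χ t ∪ χ t'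

theorem bagGraph_adj {ι : Type*} {T : SimpleGraph ι} {χ : ι → Set V} {x y : V} :
    (bagGraph T χ).Adj x y ↔
      x ≠ y ∧ ∃ t t', (t = t' ∨ T.Adj t t') ∧ x ∈ χ t ∪ χ t' ∧ y ∈ χ t ∪ χ t' := by
  simp only [bagGraph, SimpleGraph.fromRel_adj]
  constructor
  · rintro ⟨h, h' | ⟨t, t', htt, hy, hx⟩⟩
    · exact ⟨h, h'⟩
    · exact ⟨h, t, t', htt, hx, hy⟩
  · exact fun h => ⟨h.1, .inl h.2⟩

theorem isLenientTreeDecomposition_bagGraph {ι : Type*} {T : SimpleGraph ι} {χ : ι → Set V}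
    (hT : T.IsTree) (h : ∀ x, IsConnectedSet T {t | x ∈ χ t}) :
    IsLenientTreeDecomposition (bagGraph T χ) T χ :=
  ⟨hT, Set.eq_univ_of_forall fun x => Set.mem_iUnion.2 (h x).nonempty,
    fun _ _ hxy => (bagGraph_adj.1 hxy).2, h⟩

/-- A lenient tree decomposition of width at most `k`, with a minimum number of bags, of an
edge-maximal graph that has more than `2k` vertices. -/
structure IsOptimal {ι : Type} (D : SimpleGraph V) (T : SimpleGraph ι) (χ : ι → Set V)
    (k : ℕ) : Prop where
  ltd : IsLenientTreeDecomposition D T χ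
  card_le : ∀ t, (χ t).ncard ≤ k
  maximal : ∀ D', D ≤ D' → HasLenientWidth D' k → D' ≤ D
  minimal : ∀ (κ : Type) (_ : Finite κ) (T' : SimpleGraph κ) (χ' : κ → Set V),
    IsLenientTreeDecomposition D T' χ' → (∀ t, (χ' t).ncard ≤ k) → Nat.card ι ≤ Nat.card κ
  large : 2 * k < Nat.card V

variable {ι : Type} {D : SimpleGraph V} {T : SimpleGraph ι} {χ : ι → Set V} {k : ℕ}

namespace IsOptimal

theorem isTree (h : IsOptimal D T χ k) : T.IsTree := h.ltd.isTree

/-- The graph `bagGraph T χ` contains `D` and has the same decomposition, so edge-maximality makes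
it a subgraph of `D`. -/
theorem adj [Finite ι] (h : IsOptimal D T χ k) {t t' : ι} (ht : t = t' ∨ T.Adj t t') {x y : V}
    (hx : x ∈ χ t ∪ χ t') (hy : y ∈ χ t ∪ χ t') (hne : x ≠ y) : D.Adj x y := by
  refine h.maximal (bagGraph T χ) (fun x y hxy => ?_) ⟨ι, inferInstance, T, χ,
    isLenientTreeDecomposition_bagGraph h.isTree h.ltd.trace, h.card_le⟩
    (bagGraph_adj.2 ⟨hne, t, t', ht, hx, hy⟩)
  exact bagGraph_adj.2 ⟨hxy.ne, h.ltd.edge x y hxy⟩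

theorem isClique [Finite ι] (h : IsOptimal D T χ k) {t t' : ι} (ht : t = t' ∨ T.Adj t t') :
    D.IsClique (χ t ∪ χ t') := fun _ hx _ hy hne => h.adj ht hx hy hne

theorem exists_bag (h : IsOptimal D T χ k) (x : V) : ∃ t, x ∈ χ t := (h.ltd.trace x).nonempty

/-- No decomposition is obtained by removing the vertex `q`. -/
theorem not_remove [Finite ι] (h : IsOptimal D T χ k) {q : ι} {T' : SimpleGraph {s // s ≠ q}}
    {χ' : {s // s ≠ q} → Set V} (hT' : T'.IsTree)
    (hE : ∀ t t', T.Adj t t' → ∃ s s', (s = s' ∨ T'.Adj s s') ∧ χ t ∪ χ t' ⊆ χ' s ∪ χ' s')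
    (hC : ∀ x, IsConnectedSet T' {t | x ∈ χ' t}) (hk : ∀ t, (χ' t).ncard ≤ k)
    (hq : ∃ c, T.Adj q c) : False := by
  -- Every node has a neighbour, so a single bag is also handled by `hE` along a tree edge.
  have hnb : ∀ t, ∃ c, T.Adj t c := by
    intro t
    obtain ⟨c, hc⟩ := hq
    by_cases hct : t = q
    · exact ⟨c, hct ▸ hc⟩
    · obtain ⟨a, ha, -⟩ := exists_mem_side h.isTree (Ne.symm hct)
      exact ⟨a, ha⟩
  have := h.minimal _ inferInstance T' χ' ⟨hT', ?_, ?_, hC⟩ hk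
  · have h1 := Set.ncard_add_ncard_compl ({q} : Set ι)
    rw [Set.ncard_singleton] at h1
    have h2 : ({q}ᶜ : Set ι).ncard = Nat.card {s // s ≠ q} := (Nat.card_coe_set_eq _).symm
    omega
  · exact Set.eq_univ_of_forall fun x => Set.mem_iUnion.2 (hC x).nonempty
  · intro x y hxy
    obtain ⟨t, t', htt, hx, hy⟩ := h.ltd.edge x y hxy
    obtain ⟨u, u', huu, hs⟩ : ∃ u u', T.Adj u u' ∧ χ t ∪ χ t' ⊆ χ u ∪ χ u' := by
      rcases htt with rfl | htt
      · obtain ⟨c, hc⟩ := hnb t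
        exact ⟨t, c, hc, by simp⟩
      · exact ⟨t, t', htt, subset_rfl⟩
    obtain ⟨s, s', hss, hs'⟩ := hE u u' huu
    exact ⟨s, s', hss, hs' (hs hx), hs' (hs hy)⟩

/-- Otherwise contracting `t` into `a` saves a node: the bag of `a` takes over the role of the bag
of `t` at all its edges. -/
theorem not_subset [Finite ι] (h : IsOptimal D T χ k) {t a : ι} (hta : T.Adj t a) :
    ¬ χ t ⊆ χ a := by
  intro hsub
  obtain ⟨T', hT', hadj, hadj', hC⟩ := exists_contraction h.isTree hta
  refine h.not_remove (χ' := fun s => χ s) hT' ?_ (fun x => hC _ (h.ltd.trace x) fun hx => hsub hx)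
    (fun s => h.card_le s) ⟨a, hta⟩
  have key : ∀ u, T.Adj t u → ∃ s s', (s = s' ∨ T'.Adj s s') ∧ χ t ∪ χ u ⊆ χ s.1 ∪ χ s'.1 := by
    intro u hu
    refine ⟨⟨a, hta.ne.symm⟩, ⟨u, hu.ne.symm⟩, ?_, Set.union_subset_union_left _ hsub⟩
    by_cases hua : u = a
    · exact .inl (Subtype.ext hua.symm)
    · exact .inr (hadj' _ _ rfl hu fun he => hua (congrArg Subtype.val he))
  intro u u' huu
  by_cases hu : u = t
  · subst hu
    exact key u' huu
  by_cases hu' : u' = t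
  · subst hu'
    rw [Set.union_comm]
    exact key u huu.symm
  exact ⟨⟨u, hu⟩, ⟨u', hu'⟩, .inr (hadj _ _ huu), subset_rfl⟩

/-- A vertex of degree two is not covered by its neighbours. -/
theorem not_subset_union [Finite ι] (h : IsOptimal D T χ k) {t a b : ι} (hta : T.Adj t a)
    (htb : T.Adj t b) (hab : a ≠ b) (hdeg : ∀ c, T.Adj t c → c = a ∨ c = b) :
    ¬ χ t ⊆ χ a ∪ χ b := by
  intro hsub
  obtain ⟨T', hT', hadj, hadj', hC⟩ := exists_contraction h.isTree hta
  have hT'ab : T'.Adj ⟨a, hta.ne.symm⟩ ⟨b, htb.ne.symm⟩ :=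
    hadj' _ _ rfl htb fun he => hab (congrArg Subtype.val he).symm
  refine h.not_remove (χ' := fun s => χ s) hT' ?_ (fun x => ?_) (fun s => h.card_le s) ⟨a, hta⟩
  · have key : ∀ u, T.Adj t u → χ t ∪ χ u ⊆ χ a ∪ χ b := by
      intro u hu
      rcases hdeg u hu with rfl | rfl
      · exact Set.union_subset hsub Set.subset_union_left
      · exact Set.union_subset hsub Set.subset_union_right
    intro u u' huu
    by_cases hu : u = t
    · subst hu
      exact ⟨_, _, .inr hT'ab, key u' huu⟩
    by_cases hu' : u' = t
    · subst hu'
      rw [Set.union_comm]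
      exact ⟨_, _, .inr hT'ab, key u huu.symm⟩
    exact ⟨⟨u, hu⟩, ⟨u', hu'⟩, .inr (hadj _ _ huu), subset_rfl⟩
  · by_cases hx : x ∈ χ t → x ∈ χ a
    · exact hC _ (h.ltd.trace x) hx
    · push Not at hx
      have hxb : x ∈ χ b := (hsub hx.1).resolve_left hx.2
      -- Here `x` is in the bags of `t` and `b` but not of `a`, so `t` hangs from its trace at `b`
      -- alone and can be dropped.
      have := (h.ltd.trace x).sdiff (R := {t}) (b := b) hxb htb.ne.symm ?_
      · convert hC _ this (fun h => absurd rfl h.2) using 1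
        ext s
        simp [s.2]
      · rintro r rfl y hy - hry
        rcases hdeg y hry with rfl | rfl
        · exact absurd hy hx.2
        · rfl

/-- Two vertices `p` and `q` that are attached to the remaining tree at `b` cannot be merged. -/
theorem not_merge [Finite V] [Finite ι] (h : IsOptimal D T χ k) {p q b c : ι} (hpq : p ≠ q)
    (hpb : T.Adj p b) (hqb : q ≠ b) (hp : ∀ y, T.Adj p y → y = q ∨ y = b)
    (hq : ∀ y, T.Adj q y → y = p ∨ y = b) (hqc : T.Adj q c) :
    k < ((χ p ∪ χ q) \ χ b).ncard := by
  classical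
  by_contra! hk
  obtain ⟨T', hT', hadj, -, hC⟩ := exists_contraction h.isTree hqc
  let p' : {s // s ≠ q} := ⟨p, hpq⟩
  let b' : {s // s ≠ q} := ⟨b, hqb.symm⟩
  have hp'b' : T'.Adj p' b' := hadj _ _ hpb
  -- The merged node stays adjacent to `b`, so the vertices of `χ b` can be left out of its bag
  -- without losing an edge.
  let χ' : {s // s ≠ q} → Set V := fun s => if s = p' then (χ p ∪ χ q) \ χ b else χ s
  have hχp : χ' p' = (χ p ∪ χ q) \ χ b := if_pos rfl
  have hχ : ∀ s, s ≠ p' → χ' s = χ s := fun s hs => if_neg hs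
  have hu : χ p ∪ χ q ∪ χ b ⊆ χ' p' ∪ χ' b' := by
    rw [hχp, hχ b' hp'b'.ne.symm, Set.sdiff_union_self]
  refine h.not_remove (χ' := χ') hT' ?_ ?_ ?_ ⟨c, hqc⟩
  · have keyp : ∀ u, T.Adj p u → χ p ∪ χ u ⊆ χ' p' ∪ χ' b' := by
      intro u hpu
      refine Set.Subset.trans ?_ hu
      rcases hp u hpu with rfl | rfl
      · exact Set.subset_union_left
      · exact Set.union_subset_union_left _ Set.subset_union_left
    have keyq : ∀ u, T.Adj q u → χ q ∪ χ u ⊆ χ' p' ∪ χ' b' := by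
      intro u hqu
      refine Set.Subset.trans ?_ hu
      rcases hq u hqu with rfl | rfl
      · rw [Set.union_comm]
        exact Set.subset_union_left
      · exact Set.union_subset_union_left _ Set.subset_union_right
    intro u u' huu
    by_cases hup : u = p
    · subst hup
      exact ⟨_, _, .inr hp'b', keyp u' huu⟩
    by_cases huq : u = q
    · subst huq
      exact ⟨_, _, .inr hp'b', keyq u' huu⟩
    by_cases hup' : u' = p
    · subst hup'
      rw [Set.union_comm]
      exact ⟨_, _, .inr hp'b', keyp u huu.symm⟩
    by_cases huq' : u' = q
    · subst huq'
      rw [Set.union_comm]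
      exact ⟨_, _, .inr hp'b', keyq u huu.symm⟩
    refine ⟨⟨u, huq⟩, ⟨u', huq'⟩, .inr (hadj _ _ huu), ?_⟩
    rw [hχ _ fun he => hup (congrArg Subtype.val he), hχ _ fun he => hup' (congrArg Subtype.val he)]
  · intro x
    by_cases hxb : x ∈ χ b
    · have := (h.ltd.trace x).sdiff (R := {p, q}) (b := b) hxb
        (by simp [hpb.ne.symm, hqb.symm]) ?_
      · convert hC _ this (fun h => absurd (.inr rfl) h.2) using 1
        ext s
        by_cases hs : s = p'
        · subst hs
          simp [hχp, hxb, p']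
        · have : s.1 ≠ p := fun he => hs (Subtype.ext he)
          simp [hχ s hs, this, s.2]
      · rintro r (rfl | rfl) y - hy hry
        · exact (hp y hry).resolve_left fun he => hy (.inr he)
        · exact (hq y hry).resolve_left fun he => hy (.inl he)
    by_cases hx : x ∈ χ p ∪ χ q
    · have hsub : {t | x ∈ χ t} ⊆ {p, q} := by
        refine (h.ltd.trace x).subset_of_closed ?_ ?_
        · rcases hx with hx | hx
          · exact ⟨p, hx, .inl rfl⟩
          · exact ⟨q, hx, .inr rfl⟩
        · rintro r - (rfl | rfl) y hy hry
          · exact .inr ((hp y hry).resolve_right fun he => hxb (he ▸ hy))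
          · exact .inl ((hq y hry).resolve_right fun he => hxb (he ▸ hy))
      convert isConnectedSet_singleton (G := T') p' using 1
      ext s
      by_cases hs : s = p'
      · subst hs
        simpa [hχp, hxb] using hx
      · have hsp : s.1 ≠ p := fun he => hs (Subtype.ext he)
        simp only [Set.mem_ofPred_eq, hχ s hs, Set.mem_singleton_iff, hs, iff_false]
        intro hxs
        rcases hsub hxs with he | he
        · exact hsp he
        · exact s.2 he
    · convert hC _ (h.ltd.trace x) (fun h => absurd (.inr h) hx) using 1
      ext s
      by_cases hs : s = p'
      · subst hs
        simp only [Set.mem_ofPred_eq, hχp, Set.mem_sdiff, hx, false_and, Set.mem_preimage,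
          false_iff]
        exact fun h => hx (.inl h)
      · simp [hχ s hs]
  · intro s
    by_cases hs : s = p'
    · rw [hs, hχp]
      exact hk
    · rw [hχ s hs]
      exact h.card_le s

/-- Bags in different directions from `t` are separated by the bag of `t`. -/
theorem notMem_comp (h : IsOptimal D T χ k) {t a b : ι} (ha : T.Adj t a) (hb : T.Adj t b)
    (hab : a ≠ b) {x y : V} {s s' : ι} (hx : x ∈ χ s) (hs : s ∈ side T t a) (hy : y ∈ χ s')
    (hs' : s' ∈ side T t b) : y ∉ comp D (χ t) x := by
  rintro ⟨A, hA, hxA, hyA, hd⟩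
  have htr := h.ltd.trace_isConnectedSet hA
  obtain ⟨c, hc, hsub⟩ := htr.subset_side h.isTree (t := t) fun ⟨z, hz, hzA⟩ =>
    Set.disjoint_left.1 hd hzA hz
  have h1 := side_eq_of_mem h.isTree ha hc hs (hsub ⟨x, hx, hxA⟩)
  have h2 := side_eq_of_mem h.isTree hb hc hs' (hsub ⟨y, hy, hyA⟩)
  exact hab (h1.trans h2.symm)

theorem mem_of_side (h : IsOptimal D T χ k) {t a s u : ι} (ha : T.Adj t a) {x : V} (hs : x ∈ χ s)
    (hsa : s ∈ side T t a) (hu : x ∈ χ u) (hua : u ∉ side T t a) : x ∈ χ a ∧ x ∈ χ t :=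
  (h.ltd.trace x).mem_of_side h.isTree ha hsa hs hua hu

theorem not_adj (h : IsOptimal D T χ k) {t a b : ι} (ha : T.Adj t a) (hb : T.Adj t b)
    (hab : a ≠ b) {x y : V} (hx : x ∈ χ a) (hxt : x ∉ χ t) (hy : y ∈ χ b) (hyt : y ∉ χ t) :
    ¬ D.Adj x y := by
  intro hxy
  exact h.notMem_comp ha hb hab hx (mem_side_self _ _ _) hy (mem_side_self _ _ _)
    (comp_adj_mem (mem_comp_self hxt) hxy hyt)

/-- A bag with room could take a vertex `v` from the bag of `a`. This would make `v` adjacent to a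
vertex of `χ b \ χ t`, an edge that `D` lacks because `χ t` separates its ends, contradicting
edge-maximality. -/
theorem ncard_eq [Finite V] [Finite ι] (h : IsOptimal D T χ k) {t a b : ι} (ha : T.Adj t a)
    (hb : T.Adj t b) (hab : a ≠ b) : (χ t).ncard = k := by
  classical
  refine le_antisymm (h.card_le t) (not_lt.1 fun hlt => ?_)
  obtain ⟨v, hva, hvt⟩ := Set.not_subset.1 (h.not_subset ha.symm)
  obtain ⟨w, hwb, hwt⟩ := Set.not_subset.1 (h.not_subset hb.symm)
  let χ' : ι → Set V := Function.update χ t (insert v (χ t))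
  have hχt : χ' t = insert v (χ t) := Function.update_self ..
  have hχ : ∀ s, s ≠ t → χ' s = χ s := fun s hs => Function.update_of_ne hs ..
  have hsub : ∀ s, χ s ⊆ χ' s := by
    intro s
    by_cases hs : s = t
    · subst hs
      rw [hχt]
      exact Set.subset_insert _ _
    · rw [hχ s hs]
  have hD' := isLenientTreeDecomposition_bagGraph (χ := χ') h.isTree fun x => by
    by_cases hx : x = v
    · subst hx
      have := (isConnectedSet_singleton (G := T) t).union_of_adj (h.ltd.trace x) rfl hva ha
      convert this using 1
      ext s
      by_cases hs : s = t
      · subst hs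
        simp [hχt]
      · simp [hχ s hs, hs]
    · convert h.ltd.trace x using 1
      ext s
      by_cases hs : s = t
      · subst hs
        simp [hχt, hx]
      · simp [hχ s hs]
  have hne : v ≠ w := by
    rintro rfl
    exact h.notMem_comp ha hb hab hva (mem_side_self _ _ _) hwb (mem_side_self _ _ _)
      (mem_comp_self hvt)
  refine h.not_adj ha hb hab hva hvt hwb hwt (h.maximal (bagGraph T χ') (fun x y hxy => ?_)
    ⟨ι, inferInstance, T, χ', hD', fun s => ?_⟩
    (bagGraph_adj.2 ⟨hne, t, b, .inr hb, .inl ?_, .inr ?_⟩))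
  · obtain ⟨s, s', hss, hx, hy⟩ := h.ltd.edge x y hxy
    have := Set.union_subset_union (hsub s) (hsub s')
    exact bagGraph_adj.2 ⟨hxy.ne, s, s', hss, this hx, this hy⟩
  · by_cases hs : s = t
    · subst hs
      rw [hχt]
      exact (Set.ncard_insert_le _ _).trans hlt
    · rw [hχ s hs]
      exact h.card_le s
  · rw [hχt]
    exact .inl rfl
  · exact hsub b hwb

/-- A bag that is contained in the union of two adjacent bags is one of them. -/
theorem eq_or_eq_of_subset [Finite ι] (h : IsOptimal D T χ k) {s u u' : ι} (hu : T.Adj u u')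
    (hs : χ s ⊆ χ u ∪ χ u') : s = u ∨ s = u' := by
  by_contra! hne
  obtain ⟨c, hc, huc⟩ := exists_mem_side h.isTree hne.1.symm
  have hu'c : u' ∈ side T s c := by
    by_contra hu'c
    exact hne.2 (side_crossing h.isTree hc huc hu'c hu).2.symm
  refine h.not_subset hc fun x hx => ?_
  have hss := notMem_side h.isTree hc
  rcases hs hx with hx' | hx'
  · exact (h.mem_of_side hc hx' huc hx hss).1
  · exact (h.mem_of_side hc hx' hu'c hx hss).1

theorem injective [Finite ι] (h : IsOptimal D T χ k) {s t : ι} (hst : χ s = χ t) : s = t := by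
  by_contra hne
  obtain ⟨c, hc, htc⟩ := exists_mem_side h.isTree (Ne.symm hne)
  exact h.not_subset hc fun x hx =>
    (h.mem_of_side hc (hst ▸ hx) htc hx (notMem_side h.isTree hc)).1

theorem lt_ncard_biUnion [Finite V] (h : IsOptimal D T χ k) {A : Set ι} (hA : A.Nonempty)
    (hcl : ∀ x ∈ A, ∀ y, T.Adj x y → y ∈ A) : k * 2 < (⋃ t ∈ A, χ t).ncard := by
  have hAu : ∀ t, t ∈ A := by
    obtain ⟨a, ha⟩ := hA
    intro t
    by_contra ht
    exact notMem_of_no_crossing h.isTree (U := A)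
      (fun x hx y hy hxy => hy (hcl x hx y hxy)) ht a ha
  have : ⋃ t ∈ A, χ t = Set.univ := by
    rw [← h.ltd.cover]
    simp [hAu]
  rw [this, Set.ncard_univ, mul_comm]
  exact h.large

/-- Every edge of the tree has an end of degree at least two. -/
theorem exists_inner [Finite V] (h : IsOptimal D T χ k) {u u' : ι} (hu : T.Adj u u') :
    (∃ a, a ≠ u' ∧ T.Adj u a) ∨ ∃ a, a ≠ u ∧ T.Adj u' a := by
  by_contra! hcon
  have h1 := h.lt_ncard_biUnion (A := {u, u'}) ⟨u, .inl rfl⟩ (by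
    rintro x (rfl | rfl) y hy
    · by_contra hne
      exact hcon.1 y (fun he => hne (.inr he)) hy
    · by_contra hne
      exact hcon.2 y (fun he => hne (.inl he)) hy)
  rw [Set.biUnion_pair] at h1
  have h2 := Set.ncard_union_le (χ u) (χ u')
  have h3 := h.card_le u
  have h4 := h.card_le u'
  omega

theorem exists_adj [Finite V] (h : IsOptimal D T χ k) (t : ι) : ∃ a, T.Adj t a := by
  by_contra! hcon
  have h1 := h.lt_ncard_biUnion (A := {t}) ⟨t, rfl⟩ (by
    rintro x rfl y hy
    exact absurd hy (hcon y))
  rw [Set.biUnion_singleton] at h1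
  have := h.card_le t
  omega

/-- Vertices of `χ a \ χ t` and `χ b \ χ t` are separated by `χ t`, and both are adjacent to all of
it. -/
theorem isMinimalSeparator [Finite ι] (h : IsOptimal D T χ k) {t a b : ι} (ha : T.Adj t a)
    (hb : T.Adj t b) (hab : a ≠ b) : IsMinimalSeparator D (χ t) := by
  obtain ⟨x, hxa, hxt⟩ := Set.not_subset.1 (h.not_subset ha.symm)
  obtain ⟨y, hyb, hyt⟩ := Set.not_subset.1 (h.not_subset hb.symm)
  refine ⟨x, y, isSeparator_iff.2 ⟨hxt, hyt, h.notMem_comp ha hb hab hxa (mem_side_self _ _ _) hyb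
    (mem_side_self _ _ _)⟩, fun S hS hSt z hz => ?_⟩
  by_contra hzS
  obtain ⟨hxS, hyS, hxy⟩ := isSeparator_iff.1 hS
  have h1 : D.Adj x z := h.adj (.inr ha) (.inr hxa) (.inl hz) fun he => hxt (he ▸ hz)
  have h2 : D.Adj z y := h.adj (.inr hb) (.inl hz) (.inr hyb) fun he => hyt (he ▸ hz)
  exact hxy (comp_adj_mem (comp_adj_mem (mem_comp_self hxS) h1 hzS) h2 hyS)

/-- Two connected sets without common vertices and edges between them are separated by a bag. -/
theorem exists_separating_bag [Finite ι] (h : IsOptimal D T χ k) {A B : Set V}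
    (hA : IsConnectedSet D A) (hB : IsConnectedSet D B) (hAB : Disjoint A B)
    (hadj : ∀ x ∈ A, ∀ y ∈ B, ¬ D.Adj x y) :
    ∃ t a b, T.Adj t a ∧ T.Adj t b ∧ a ≠ b ∧ (χ a ∩ A).Nonempty ∧
      {s | (χ s ∩ A).Nonempty} ⊆ side T t a ∧ {s | (χ s ∩ B).Nonempty} ⊆ side T t b := by
  have hno : ∀ s s', (s = s' ∨ T.Adj s s') → (χ s ∩ A).Nonempty → (χ s' ∩ B).Nonempty → False := by
    rintro s s' hss ⟨x, hxs, hx⟩ ⟨y, hys, hy⟩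
    by_cases hxy : x = y
    · exact Set.disjoint_left.1 hAB hx (hxy ▸ hy)
    · exact hadj x hx y hy (h.adj hss (.inl hxs) (.inr hys) hxy)
  exact exists_separating_vertex h.isTree (h.ltd.trace_isConnectedSet hA)
    (h.ltd.trace_isConnectedSet hB) (Set.disjoint_left.2 fun s hs hs' => hno s s (.inl rfl) hs hs')
    fun a ha b hb hab => hno a b (.inr hab) ha hb

/-- Separate the component of `x` from `y` by a bag `χ t` next to the component. A vertex of the
component in the adjacent bag is adjacent to all of `χ t`, which puts `χ t` inside `S`; minimality
gives equality. -/
theorem exists_eq_of_isMinimalSeparator [Finite ι] (h : IsOptimal D T χ k) {S : Set V}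
    (hS : IsMinimalSeparator D S) : ∃ t a b, T.Adj t a ∧ T.Adj t b ∧ a ≠ b ∧ S = χ t := by
  obtain ⟨x, y, hmin⟩ := hS
  obtain ⟨hxS, hyS, hxy⟩ := isSeparator_iff.1 hmin.1
  obtain ⟨t, a, b, ha, hb, hab, ⟨c, hca, hc⟩, hsa, hsb⟩ := h.exists_separating_bag
    (comp_isConnectedSet hxS) (isConnectedSet_singleton y) (by simpa using hxy)
    (by rintro p hp q rfl hpq; exact hxy (comp_adj_mem hp hpq hyS))
  refine ⟨t, a, b, ha, hb, hab, ?_⟩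
  have htx : ¬ (χ t ∩ comp D S x).Nonempty := fun ht => notMem_side h.isTree ha (hsa ht)
  have hsub : χ t ⊆ S := by
    intro w hw
    by_contra hwS
    have hcw : c ≠ w := by
      rintro rfl
      exact htx ⟨c, hw, hc⟩
    exact htx ⟨w, hw, comp_adj_mem hc (h.adj (.inr ha) (.inr hca) (.inl hw) hcw) hwS⟩
  obtain ⟨s, hs⟩ := h.exists_bag x
  obtain ⟨s', hs'⟩ := h.exists_bag y
  refine (hmin.2 (isSeparator_iff.2 ⟨fun hx => hxS (hsub hx), fun hy => hyS (hsub hy), ?_⟩)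
    hsub).antisymm hsub
  exact h.notMem_comp ha hb hab hs (hsa ⟨x, hs, mem_comp_self hxS⟩) hs' (hsb ⟨y, hs', rfl⟩)

/-- If the traces meet pairwise, Helly gives one bag. Otherwise two disjoint traces are joined by a
tree edge `tt'`, and a vertex outside these two bags has its trace on one side, out of reach of the
trace beyond the edge. -/
theorem exists_subset_of_isClique [Finite V] [Finite ι] (h : IsOptimal D T χ k) {K : Set V}
    (hK : D.IsClique K) : ∃ u u', T.Adj u u' ∧ K ⊆ χ u ∪ χ u' := by
  by_cases hI : ∀ x ∈ K, ∀ y ∈ K, ∃ t, x ∈ χ t ∧ y ∈ χ t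
  · have hex : ∃ t, ∀ A ∈ (fun x => {t | x ∈ χ t}) '' K, t ∈ A := by
      refine exists_mem_of_pairwise_inter h.isTree ?_ ?_
      · rintro _ ⟨x, -, rfl⟩
        exact h.ltd.trace x
      · rintro _ ⟨x, hx, rfl⟩ _ ⟨y, hy, rfl⟩
        exact hI x hx y hy
    obtain ⟨t, ht⟩ := hex
    obtain ⟨a, ha⟩ := h.exists_adj t
    exact ⟨t, a, ha, fun x hx => .inl (ht _ ⟨x, hx, rfl⟩)⟩
  push Not at hI
  obtain ⟨x, hx, y, hy, hxy⟩ := hI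
  have key : ∀ {p q : V}, D.Adj p q → ∃ t t', (t = t' ∨ T.Adj t t') ∧ p ∈ χ t ∧ q ∈ χ t' := by
    intro p q hpq
    obtain ⟨t, t', htt, hp, hq⟩ := h.ltd.edge p q hpq
    rcases hp with hp | hp <;> rcases hq with hq | hq
    · exact ⟨t, t, .inl rfl, hp, hq⟩
    · exact ⟨t, t', htt, hp, hq⟩
    · exact ⟨t', t, htt.imp Eq.symm fun h => h.symm, hp, hq⟩
    · exact ⟨t', t', .inl rfl, hp, hq⟩
  have hne : x ≠ y := by
    rintro rfl
    obtain ⟨t, ht⟩ := h.exists_bag x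
    exact hxy t ht ht
  obtain ⟨t, t', htt, hxt, hyt'⟩ := key (hK hx hy hne)
  replace htt : T.Adj t t' := htt.resolve_left fun he => hxy t hxt (he ▸ hyt')
  refine ⟨t, t', htt, fun z hz => ?_⟩
  by_contra hzt
  have aux : ∀ {x y : V} {t t' : ι}, T.Adj t t' → x ∈ χ t → y ∈ χ t' → (∀ s, x ∈ χ s → y ∉ χ s) →
      z ∉ χ t → z ∉ χ t' → {s | z ∈ χ s} ⊆ side T t' t → ¬ D.Adj z y := by
    intro x y t t' htt hxt hyt' hxy hzt hzt' hsub hzy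
    obtain ⟨s, s', hss, hs, hs'⟩ := key hzy
    have hst := hsub hs
    by_cases hs't : s' ∈ side T t' t
    · exact hxy t hxt ((h.mem_of_side htt.symm hs' hs't hyt' (notMem_side h.isTree htt.symm)).1)
    · rcases hss with rfl | hss
      · exact hs't hst
      · have := (side_crossing h.isTree htt.symm hst hs't hss).1
        exact hzt (this ▸ hs)
  have hzx : z ≠ x := fun he => hzt (.inl (he ▸ hxt))
  have hzy : z ≠ y := fun he => hzt (.inr (he ▸ hyt'))
  obtain ⟨s, hs⟩ := h.exists_bag z
  rcases mem_side_or h.isTree htt s with hst | hst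
  · refine aux htt.symm hyt' hxt (fun s hy hx => hxy s hx hy) (fun h => hzt (.inr h))
      (fun h => hzt (.inl h)) (fun u hu => ?_) (hK hz hx hzx)
    by_contra hut
    exact hzt (.inl (h.mem_of_side htt hs hst hu hut).2)
  · refine aux htt hxt hyt' hxy (fun h => hzt (.inl h)) (fun h => hzt (.inr h)) (fun u hu => ?_)
      (hK hz hy hzy)
    by_contra hut
    exact hzt (.inr (h.mem_of_side htt.symm hs hst hu hut).2)

theorem eq_union_of_isMaxClique [Finite V] [Finite ι] (h : IsOptimal D T χ k) {K : Set V}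
    (hK : IsMaxClique D K) : ∃ u u', T.Adj u u' ∧ K = χ u ∪ χ u' := by
  obtain ⟨u, u', hu, hsub⟩ := h.exists_subset_of_isClique hK.1
  exact ⟨u, u', hu, hsub.antisymm (hK.2 (h.isClique (.inr hu)) hsub)⟩

end IsOptimal

end Optimal

/-! ### Optimal graphs are domino-trees. -/

namespace IsOptimal

variable {V : Type*} {ι : Type} {D : SimpleGraph V} {T : SimpleGraph ι} {χ : ι → Set V} {k : ℕ}

/-- A bag that separates `g 0` from `g 2` on a hole meets both arcs between them, in `g 1` and in
some `g j` with `j ≥ 3`. Bags are cliques, so this gives a chord. -/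
theorem isChordal [Finite ι] (h : IsOptimal D T χ k) : IsChordal D := by
  rintro n hn ⟨f⟩
  by_contra hn3
  obtain ⟨m, rfl⟩ : ∃ m, n = m + 4 := ⟨n - 4, by omega⟩
  have hadj : ∀ i j : Fin (m + 4), i < j → (D.Adj (f i) (f j) ↔
      (j : ℕ) = i + 1 ∨ ((i : ℕ) = 0 ∧ (j : ℕ) = m + 3)) := by
    intro i j hij
    have hij' : (i : ℕ) < j := hij
    have hj := j.2
    rw [f.map_adj_iff, SimpleGraph.cycleGraph_adj', Fin.sub_val_of_le hij.le,
      Fin.coe_sub_iff_lt.2 hij]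
    omega
  let g : ℕ → V := fun i => f (Fin.ofNat (m + 4) i)
  have hg : ∀ i (hi : i < m + 4), g i = f ⟨i, hi⟩ := fun i hi => by
    simp only [g]
    congr 1
    exact Fin.ext (Nat.mod_eq_of_lt hi)
  have hgadj : ∀ i j, i < j → j < m + 4 →
      (D.Adj (g i) (g j) ↔ j = i + 1 ∨ (i = 0 ∧ j = m + 3)) := by
    intro i j hij hj
    rw [hg i (hij.trans hj), hg j hj]
    exact hadj _ _ hij
  have hginj : ∀ i j, i < m + 4 → j < m + 4 → g i = g j → i = j := by
    intro i j hi hj hij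
    rw [hg i hi, hg j hj] at hij
    exact congrArg Fin.val (f.injective hij)
  have h02 : ¬ D.Adj (g 0) (g 2) := by
    rw [hgadj 0 2 (by omega) (by omega)]
    omega
  obtain ⟨t, a, b, ha, hb, hab, -, hsa, hsb⟩ := h.exists_separating_bag
    (isConnectedSet_singleton (g 0)) (isConnectedSet_singleton (g 2))
    (by simpa using fun he => absurd (hginj 0 2 (by omega) (by omega) he) (by omega))
    (by rintro p rfl q rfl; exact h02)
  obtain ⟨s, hs⟩ := h.exists_bag (g 0)
  obtain ⟨s', hs'⟩ := h.exists_bag (g 2)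
  have hsep := h.notMem_comp ha hb hab hs (hsa ⟨_, hs, rfl⟩) hs' (hsb ⟨_, hs', rfl⟩)
  have ht0 : g 0 ∉ χ t := fun ht => notMem_side h.isTree ha (hsa ⟨_, ht, rfl⟩)
  have ht2 : g 2 ∉ χ t := fun ht => notMem_side h.isTree hb (hsb ⟨_, ht, rfl⟩)
  have ht1 : g 1 ∈ χ t := by
    by_contra ht1
    refine hsep (comp_adj_mem (comp_adj_mem (mem_comp_self ht0) ?_ ht1) ?_ ht2)
    · exact (hgadj 0 1 (by omega) (by omega)).2 (by omega)
    · exact (hgadj 1 2 (by omega) (by omega)).2 (by omega)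
  obtain ⟨j, hj3, hjn, hj⟩ : ∃ j, 3 ≤ j ∧ j < m + 4 ∧ g j ∈ χ t := by
    by_contra! hno
    have hcomp : ∀ i, i ≤ m + 1 → g (m + 3 - i) ∈ comp D (χ t) (g 0) := by
      intro i
      induction i with
      | zero =>
        intro _
        refine comp_adj_mem (mem_comp_self ht0) ?_ (hno _ (by omega) (by omega))
        exact (hgadj 0 _ (by omega) (by omega)).2 (by omega)
      | succ i ih =>
        intro hi
        refine comp_adj_mem (ih (by omega)) ((hgadj _ _ (by omega) (by omega)).2 (.inl ?_)).symm ?_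
        · omega
        · by_cases hi' : i = m
          · rwa [show m + 3 - (i + 1) = 2 by omega]
          · exact hno _ (by omega) (by omega)
    refine hsep ?_
    convert hcomp (m + 1) le_rfl using 2
    omega
  have hne : g 1 ≠ g j := fun he => by
    have := hginj 1 j (by omega) hjn he
    omega
  have := (hgadj 1 j (by omega) hjn).1 (h.adj (.inl rfl) (.inl ht1) (.inl hj) hne)
  omega

theorem separatorsIn_subset [Finite ι] (h : IsOptimal D T χ k) {u u' : ι} (hu : T.Adj u u')
    {S : Set V} (hS : S ∈ separatorsIn D (χ u ∪ χ u')) : S = χ u ∨ S = χ u' := by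
  obtain ⟨hS, hsub⟩ := hS
  obtain ⟨t, -, -, -, -, -, rfl⟩ := h.exists_eq_of_isMinimalSeparator hS
  exact (h.eq_or_eq_of_subset hu hsub).imp (congrArg χ) (congrArg χ)

/-- Each neighbour of `t` contributes a vertex outside `χ t`, and different neighbours give
different components of `D - χ t`. -/
theorem eq_or_eq_of_connectivityDegree [Finite V] [Finite ι] (h : IsOptimal D T χ k) {t a b : ι}
    (hdeg : connectivityDegree D (χ t) = 2) (ha : T.Adj t a) (hb : T.Adj t b) (hab : a ≠ b)
    {c : ι} (hc : T.Adj t c) : c = a ∨ c = b := by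
  have hex : ∀ c : {c // T.Adj t c}, ∃ x, x ∈ χ c.1 ∧ x ∉ χ t := fun c =>
    Set.not_subset.1 (h.not_subset c.2.symm)
  choose x hx hxt using hex
  have hinj : Function.Injective fun c : {c // T.Adj t c} =>
      (D.induce (χ t)ᶜ).connectedComponentMk ⟨x c, hxt c⟩ := by
    intro c c' hcc
    by_contra hne
    have := SimpleGraph.ConnectedComponent.exact hcc
    rw [reachable_induce_compl_iff] at this
    exact h.notMem_comp c.2 c'.2 (fun he => hne (Subtype.ext he)) (hx c) (mem_side_self _ _ _)
      (hx c') (mem_side_self _ _ _) this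
  have hcard := Nat.card_le_card_of_injective _ hinj
  rw [connectivityDegree] at hdeg
  rw [hdeg] at hcard
  by_contra! hne
  have h3 : ({a, b, c} : Set ι).ncard = 3 :=
    Set.ncard_eq_three.2 ⟨a, b, c, hab, hne.1.symm, hne.2.symm, rfl⟩
  have h4 : ({a, b, c} : Set ι).ncard ≤ {c | T.Adj t c}.ncard := Set.ncard_le_ncard (by
    rintro _ (rfl | rfl | rfl)
    exacts [ha, hb, hc])
  have h5 : {c | T.Adj t c}.ncard = Nat.card {c // T.Adj t c} := (Nat.card_coe_set_eq _).symm
  omega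

/-- External maximal cliques correspond to leaves of the tree. -/
theorem exists_leaf_of_mem_externalFamily [Finite V] [Finite ι] (h : IsOptimal D T χ k) {t a b : ι}
    (ha : T.Adj t a) (hb : T.Adj t b) (hab : a ≠ b) {K : Set V}
    (hK : K ∈ externalFamily D (χ t)) :
    ∃ l, T.Adj t l ∧ K = χ t ∪ χ l ∧ ∀ c, T.Adj l c → c = t := by
  obtain ⟨hKmax, hcard, hsub⟩ := hK
  obtain ⟨l, hl, rfl⟩ : ∃ l, T.Adj t l ∧ K = χ t ∪ χ l := by
    obtain ⟨u, u', hu, rfl⟩ := h.eq_union_of_isMaxClique hKmax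
    rcases h.eq_or_eq_of_subset hu hsub with rfl | rfl
    · exact ⟨u', hu, rfl⟩
    · exact ⟨u, hu.symm, Set.union_comm _ _⟩
  refine ⟨l, hl, rfl, fun c hc => ?_⟩
  by_contra hct
  have h1 : χ t ∈ separatorsIn D (χ t ∪ χ l) :=
    ⟨h.isMinimalSeparator ha hb hab, Set.subset_union_left⟩
  have h2 : χ l ∈ separatorsIn D (χ t ∪ χ l) :=
    ⟨h.isMinimalSeparator hc hl.symm hct, Set.subset_union_right⟩
  have := (Set.ncard_le_one (Set.toFinite _)).1 hcard _ h1 _ h2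
  exact hl.ne (h.injective this)

/-- An optimal graph is a `k`-domino-tree. -/
theorem dominoProperties [Finite V] [Finite ι] (h : IsOptimal D T χ k) : DominoProperties D k where
  chordal := h.isChordal
  separator_card S hS := by
    obtain ⟨t, a, b, ha, hb, hab, rfl⟩ := h.exists_eq_of_isMinimalSeparator hS
    exact h.ncard_eq ha hb hab
  clique_card K hK := by
    obtain ⟨u, u', hu, rfl⟩ := h.eq_union_of_isMaxClique hK
    have h1 := Set.ncard_union_le (χ u) (χ u')
    have h2 := h.card_le u
    have h3 := h.card_le u'
    refine ⟨?_, by omega⟩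
    have key : ∀ {u u' a}, T.Adj u u' → a ≠ u' → T.Adj u a → k + 1 ≤ (χ u ∪ χ u').ncard := by
      intro u u' a hu hne ha
      have : χ u ⊂ χ u ∪ χ u' := ⟨Set.subset_union_left, fun hs =>
        h.not_subset hu.symm (Set.subset_union_right.trans hs)⟩
      have := Set.ncard_lt_ncard this
      rwa [h.ncard_eq ha hu hne] at this
    rcases h.exists_inner hu with ⟨a, hne, ha⟩ | ⟨a, hne, ha⟩
    · exact key hu hne ha
    · rw [Set.union_comm]
      exact key hu.symm hne ha
  clique_separators K hK := by
    obtain ⟨u, u', hu, rfl⟩ := h.eq_union_of_isMaxClique hK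
    refine (Set.ncard_le_ncard (t := {χ u, χ u'}) fun S hS => h.separatorsIn_subset hu hS).trans ?_
    exact (Set.ncard_insert_le _ _).trans (by rw [Set.ncard_singleton])
  clique_eq_union K hK S S' hne hsep := by
    obtain ⟨u, u', hu, rfl⟩ := h.eq_union_of_isMaxClique hK
    have h1 := h.separatorsIn_subset hu (S := S) (hsep ▸ .inl rfl)
    have h2 := h.separatorsIn_subset hu (S := S') (hsep ▸ .inr rfl)
    rcases h1 with rfl | rfl <;> rcases h2 with rfl | rfl
    · exact absurd rfl hne
    · rfl
    · exact Set.union_comm _ _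
    · exact absurd rfl hne
  internal_two S hS hdeg S₁ S₂ h₁ h₂ hne₁ hne₂ hne hsub := by
    obtain ⟨t, a, b, ha, hb, hab, rfl⟩ := h.exists_eq_of_isMinimalSeparator hS.1
    obtain ⟨s₁, -, -, -, -, -, rfl⟩ := h.exists_eq_of_isMinimalSeparator h₁
    obtain ⟨s₂, -, -, -, -, -, rfl⟩ := h.exists_eq_of_isMinimalSeparator h₂
    -- What a distant bag shares with `χ t` passes through the neighbour of `t` in its direction, so
    -- (vi) reduces to `not_subset_union`.
    have hdir : ∀ {s}, χ s ≠ χ t → ∃ c, T.Adj t c ∧ χ t ∩ χ s ⊆ χ c := by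
      intro s hs
      obtain ⟨c, hc, hsc⟩ := exists_mem_side h.isTree (t := t) (s := s) fun he => hs (he ▸ rfl)
      exact ⟨c, hc, fun x hx => (h.mem_of_side hc hx.2 hsc hx.1 (notMem_side h.isTree hc)).1⟩
    obtain ⟨c₁, hc₁, hs₁⟩ := hdir hne₁
    obtain ⟨c₂, hc₂, hs₂⟩ := hdir hne₂
    refine h.not_subset_union ha hb hab
      (fun c hc => h.eq_or_eq_of_connectivityDegree hdeg ha hb hab hc) fun x hx => ?_
    have hx' : ∃ c, T.Adj t c ∧ x ∈ χ c := by
      rcases hsub hx with hx' | hx'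
      · exact ⟨c₁, hc₁, hs₁ ⟨hx, hx'⟩⟩
      · exact ⟨c₂, hc₂, hs₂ ⟨hx, hx'⟩⟩
    obtain ⟨c, hc, hxc⟩ := hx'
    rcases h.eq_or_eq_of_connectivityDegree hdeg ha hb hab hc with rfl | rfl
    · exact .inl hxc
    · exact .inr hxc
  external_two S hS hdeg := by
    obtain ⟨t, a, b, ha, hb, hab, rfl⟩ := h.exists_eq_of_isMinimalSeparator hS.1
    obtain ⟨K, hK⟩ := hS.2
    obtain ⟨l, hl, -, hleaf⟩ := h.exists_leaf_of_mem_externalFamily ha hb hab hK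
    obtain ⟨b, hlb, hb⟩ : ∃ b, l ≠ b ∧ T.Adj t b := by
      by_cases hla : l = a
      · exact ⟨b, hla ▸ hab, hb⟩
      · exact ⟨a, hla, ha⟩
    have hnb : ∀ c, T.Adj t c → c = l ∨ c = b := fun c hc =>
      h.eq_or_eq_of_connectivityDegree hdeg hl hb hlb hc
    have hin : ∀ c, T.Adj t c → χ t ∪ χ c ⊆ ⋃₀ {K | IsMaxClique D K ∧ χ t ⊆ K} := by
      intro c hc
      obtain ⟨K, hsub, hK⟩ := exists_maximal_ge_of_wellFoundedGT D.IsClique _ (h.isClique (.inr hc))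
      exact hsub.trans (Set.subset_sUnion_of_mem ⟨hK, Set.subset_union_left.trans hsub⟩)
    have hle := Set.ncard_le_ncard (Set.union_subset (hin l hl) (hin b hb))
    refine lt_of_lt_of_le ?_ hle
    rw [show χ t ∪ χ l ∪ (χ t ∪ χ b) = χ t ∪ χ l ∪ χ b by
      ext x
      simp only [Set.mem_union]
      tauto]
    -- If `b` is inner, its bag has size `k` and merging `t` with the leaf `l` must fail, leaving
    -- more than `k` vertices outside. If `b` is a leaf, the tree is just `l - t - b` and the union
    -- is all of `V`.
    by_cases hbin : ∃ d, d ≠ t ∧ T.Adj b d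
    · obtain ⟨d, hdt, hd⟩ := hbin
      have h1 := h.not_merge hl.ne hb hlb hnb (fun y hy => .inl (hleaf y hy)) hl.symm
      have h2 := h.ncard_eq hd hb.symm hdt
      have h3 := Set.ncard_sdiff_add_ncard (χ t ∪ χ l) (χ b)
      omega
    · push Not at hbin
      have h1 := h.lt_ncard_biUnion (A := {t, l, b}) ⟨t, .inl rfl⟩ (by
        rintro x (rfl | rfl | rfl) y hy
        · exact .inr (hnb y hy)
        · exact .inl (hleaf y hy)
        · exact .inl (by_contra fun hyt => hbin y hyt hy))
      have heq : ⋃ s ∈ ({t, l, b} : Set ι), χ s = χ t ∪ χ l ∪ χ b := by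
        rw [Set.biUnion_insert, Set.biUnion_pair, Set.union_assoc]
      rw [heq] at h1
      omega
  external_valiancy S hS K hK K' hK' hne := by
    obtain ⟨t, a, b, ha, hb, hab, rfl⟩ := h.exists_eq_of_isMinimalSeparator hS.1
    obtain ⟨l, hl, rfl, hleaf⟩ := h.exists_leaf_of_mem_externalFamily ha hb hab hK
    obtain ⟨l', hl', rfl, hleaf'⟩ := h.exists_leaf_of_mem_externalFamily ha hb hab hK'
    have hll : l ≠ l' := by
      rintro rfl
      exact hne rfl
    -- Merging the two leaves at `t` must fail, which bounds their parts outside `χ t` from below.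
    have h1 := h.not_merge hll hl.symm hl'.ne.symm (fun y hy => .inr (hleaf y hy))
      (fun y hy => .inr (hleaf' y hy)) hl'.symm
    rw [Set.union_sdiff_distrib] at h1
    rw [Set.union_sdiff_left, Set.union_sdiff_left]
    exact h1.trans_le (Set.ncard_union_le _ _)

end IsOptimal

/-! ### Assembly of the equivalences. -/

section Main

variable {V : Type*}

theorem dominoProperties_top [Finite V] {k : ℕ} (hk : k < Nat.card V) (h : Nat.card V ≤ 2 * k) :
    DominoProperties (⊤ : SimpleGraph V) k := by
  have hns : ∀ S : Set V, ¬ IsMinimalSeparator ⊤ S := by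
    rintro S ⟨x, y, hS⟩
    obtain ⟨hx, hy, hxy⟩ := isSeparator_iff.1 hS.1
    by_cases hne : x = y
    · exact hxy (hne ▸ mem_comp_self hx)
    · exact hxy (comp_adj_mem (mem_comp_self hx) hne hy)
  have hsep : ∀ K : Set V, separatorsIn ⊤ K = ∅ := fun K =>
    Set.eq_empty_of_forall_notMem fun S hS => hns S hS.1
  refine ⟨?_, fun S hS => absurd hS (hns S), ?_, ?_, ?_, fun S hS => absurd hS.1 (hns S),
    fun S hS => absurd hS.1 (hns S), fun S hS => absurd hS.1 (hns S)⟩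
  · rintro n hn ⟨f⟩
    by_contra hn3
    obtain ⟨m, rfl⟩ : ∃ m, n = m + 4 := ⟨n - 4, by omega⟩
    have hlt : (⟨0, by omega⟩ : Fin (m + 4)) < ⟨2, by omega⟩ := by simp [Fin.lt_def]
    have : (SimpleGraph.cycleGraph (m + 4)).Adj ⟨0, by omega⟩ ⟨2, by omega⟩ :=
      f.map_adj_iff.1 (f.injective.ne hlt.ne)
    rw [SimpleGraph.cycleGraph_adj', Fin.sub_val_of_le hlt.le, Fin.coe_sub_iff_lt.2 hlt] at this
    simp only at this
    omega
  · intro K hK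
    have : K = Set.univ := Set.univ_subset_iff.1
      (hK.2 (fun _ _ _ _ hne => hne) (Set.subset_univ K))
    rw [this, Set.ncard_univ]
    exact ⟨hk, h⟩
  · intro K _
    simp [hsep]
  · intro K _ S S' _ he
    rw [hsep] at he
    exact absurd (he.symm.subset (Set.mem_insert S {S'})) (Set.notMem_empty S)

/-- Small vertex sets are handled by complete graphs because optimality needs more than `2k`
vertices, to exclude trees with one edge and to obtain (vii). -/
theorem HasLenientWidth.isPartialDominoTree [Finite V] {G : SimpleGraph V} {k : ℕ}
    (h : HasLenientWidth G k) : IsPartialDominoTree G k := by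
  by_cases hk : Nat.card V ≤ k
  · exact ⟨⊤, le_top, .inl ⟨rfl, hk⟩⟩
  by_cases h2k : Nat.card V ≤ 2 * k
  · exact ⟨⊤, le_top, .inr (dominoProperties_top (not_le.1 hk) h2k)⟩
  obtain ⟨D, hGD, hD⟩ := exists_maximal_ge_of_wellFoundedGT (fun D => HasLenientWidth D k) G h
  have hex : ∃ n, ∃ (ι : Type) (_ : Finite ι) (T : SimpleGraph ι) (χ : ι → Set V),
      (IsLenientTreeDecomposition D T χ ∧ ∀ t, (χ t).ncard ≤ k) ∧ Nat.card ι = n := by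
    obtain ⟨ι, hι, T, χ, hT⟩ := hD.1
    exact ⟨_, ι, hι, T, χ, hT, rfl⟩
  classical
  obtain ⟨ι, _, T, χ, ⟨hT, hχ⟩, hn⟩ := Nat.find_spec hex
  have hopt : IsOptimal D T χ k := ⟨hT, hχ, fun D' hle hD' => hD.2 hD' hle,
    fun κ hκ T' χ' hT' hχ' => hn.le.trans (Nat.find_min' hex ⟨κ, hκ, T', χ', ⟨hT', hχ'⟩, rfl⟩),
    not_le.1 h2k⟩
  exact ⟨D, hGD, .inr hopt.dominoProperties⟩

theorem IsPartialDominoTree.not_lt_order [Finite V] {G : SimpleGraph V} {k : ℕ}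
    (h : IsPartialDominoTree G k) {B : Set (Set V)} (hB : IsStrictBramble G B) :
    ¬ k < order B := by
  obtain ⟨D, hGD, hD⟩ := h
  have hB' : IsStrictBramble D B :=
    ⟨fun S hS => (hB.connected S hS).mono_graph fun _ _ _ _ h => hGD h, hB.intersecting⟩
  rcases hD with ⟨-, hk⟩ | hD
  · intro hlt
    have := (lt_order_iff hB).1 hlt _ (covers_univ hB)
    rw [Set.ncard_univ] at this
    omega
  · exact hD.not_lt_order hB'

theorem order_le_card [Finite V] {G : SimpleGraph V} {B : Set (Set V)} (hB : IsStrictBramble G B) :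
    order B ≤ Nat.card V := by
  by_contra! h
  have := (lt_order_iff hB).1 h _ (covers_univ hB)
  rw [Set.ncard_univ] at this
  omega

theorem isGreatest_sbn [Finite V] (G : SimpleGraph V) :
    IsGreatest (strictBrambleOrders G) (sbn G) := by
  have hne : (strictBrambleOrders G).Nonempty := ⟨_, ∅, ⟨by simp, by simp⟩, rfl⟩
  have hbdd : BddAbove (strictBrambleOrders G) := by
    refine ⟨Nat.card V, ?_⟩
    rintro _ ⟨B, hB, rfl⟩
    exact order_le_card hB
  exact ⟨Nat.sSup_mem hne hbdd, fun n hn => le_csSup hbdd hn⟩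

theorem sbn_le_iff [Finite V] {G : SimpleGraph V} {k : ℕ} :
    sbn G ≤ k ↔ ¬ ∃ B : Set (Set V), IsStrictBramble G B ∧ k < order B := by
  obtain ⟨⟨B, hB, hBo⟩, hmax⟩ := isGreatest_sbn G
  constructor
  · rintro h ⟨B', hB', hlt⟩
    exact absurd (hmax ⟨B', hB', rfl⟩) (by omega)
  · intro h
    by_contra hlt
    exact h ⟨B, hB, by omega⟩

theorem tfae_lenient [Finite V] (G : SimpleGraph V) (k : ℕ) : List.TFAE
    [IsMinorOfTreeProduct G k,
      ∃ (ι : Type) (_ : Finite ι) (T : SimpleGraph ι) (χ : ι → Set V),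
        IsLenientTreeDecomposition G T χ ∧ width χ ≤ k,
      ¬ ∃ B : Set (Set V), IsStrictBramble G B ∧ k < order B,
      IsPartialDominoTree G k] := by
  tfae_have 1 → 2 := by
    rintro ⟨ι, hι, T, hT, h⟩
    obtain ⟨χ, hχ, hk⟩ := exists_lenientTreeDecomposition_of_minor hT h
    exact ⟨ι, hι, T, χ, hχ, width_le_iff.2 hk⟩
  tfae_have 2 → 1 := by
    rintro ⟨ι, hι, T, χ, hχ, hk⟩
    exact ⟨ι, hι, T, hχ.isTree, isMinor_of_lenientTreeDecomposition hχ (width_le_iff.1 hk)⟩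
  tfae_have 3 → 2 := by
    intro h
    obtain ⟨ι, hι, T, χ, hχ, hk⟩ := exists_lenientTreeDecomposition_of_not_bramble h
    exact ⟨ι, hι, T, χ, hχ, width_le_iff.2 hk⟩
  tfae_have 2 → 4 := by
    rintro ⟨ι, hι, T, χ, hχ, hk⟩
    exact HasLenientWidth.isPartialDominoTree ⟨ι, hι, T, χ, hχ, width_le_iff.1 hk⟩
  tfae_have 4 → 3 := by
    rintro h ⟨B, hB, hlt⟩
    exact h.not_lt_order hB hlt
  tfae_finish

end Main

end LenientTree

theorem mainTheorem1 {V : Type*} [Finite V] (G : SimpleGraph V) :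
    (∀ k : ℕ, List.TFAE
      [∃ (ι : Type) (_ : Finite ι) (T : SimpleGraph ι),
          T.IsTree ∧ LenientTree.IsMinor G (LenientTree.lexProduct T (⊤ : SimpleGraph (Fin k))),
        ∃ (ι : Type) (_ : Finite ι) (T : SimpleGraph ι) (χ : ι → Set V),
          LenientTree.IsLenientTreeDecomposition G T χ ∧ LenientTree.width χ ≤ k,
        ¬ ∃ B : Set (Set V), LenientTree.IsStrictBramble G B ∧ k < LenientTree.order B,
        LenientTree.IsPartialDominoTree G k]) ∧
    IsGreatest (LenientTree.strictBrambleOrders G) (LenientTree.sbn G) ∧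
    IsLeast {k : ℕ | LenientTree.IsMinorOfTreeProduct G k} (LenientTree.ltp G) ∧
    LenientTree.sbn G = LenientTree.ltp G ∧
    IsLeast (LenientTree.lenientWidths G) (LenientTree.sbn G) := by
  -- All parameters are compared through the single condition `sbn G ≤ k`, so the extremal values
  -- coincide.
  have h13 : ∀ k, LenientTree.IsMinorOfTreeProduct G k ↔ LenientTree.sbn G ≤ k := fun k =>
    ((LenientTree.tfae_lenient G k).out 0 2).trans LenientTree.sbn_le_iff.symm
  have h23 : ∀ k, (∃ (ι : Type) (_ : Finite ι) (T : SimpleGraph ι) (χ : ι → Set V),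
      LenientTree.IsLenientTreeDecomposition G T χ ∧ LenientTree.width χ ≤ k) ↔
        LenientTree.sbn G ≤ k := fun k =>
    ((LenientTree.tfae_lenient G k).out 1 2).trans LenientTree.sbn_le_iff.symm
  have hltp : IsLeast {k : ℕ | LenientTree.IsMinorOfTreeProduct G k} (LenientTree.ltp G) :=
    ⟨Nat.sInf_mem ⟨_, (h13 _).2 le_rfl⟩, fun _ hk => Nat.sInf_le hk⟩
  refine ⟨LenientTree.tfae_lenient G, LenientTree.isGreatest_sbn G, hltp,
    le_antisymm ((h13 _).1 hltp.1) (hltp.2 ((h13 _).2 le_rfl)), ?_, ?_⟩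
  · obtain ⟨ι, hι, T, χ, hχ, hw⟩ := (h23 _).2 le_rfl
    exact ⟨ι, hι, T, χ, hχ, le_antisymm hw ((h23 _).1 ⟨ι, hι, T, χ, hχ, le_rfl⟩)⟩
  · rintro w ⟨ι, hι, T, χ, hχ, rfl⟩
    exact (h23 _).1 ⟨ι, hι, T, χ, hχ, le_rfl⟩
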